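/- **Setting.** Fix a propositional language $\mathcal L$ containing $\wedge,\vee,\to,*$ (binary) and $\top,\bot,1,0$ (constants), possibly a unary modality $\Box$, and possibly further connectives; the distinguished connectives need not be distinct symbols. All sequents are single-conclusion: $\Gamma\Rightarrow\Delta$ with $\Gamma,\Delta$ finite multisets of formulas and $|\Delta|\le 1$. For $S=(\Gamma\Rightarrow\Delta)$ put $S^s=\Delta$ and $\tilde S=(\Gamma\Rightarrow)$; moreover $(\Gamma\Rightarrow\Delta)\cdot(\Gamma'\Rightarrow\Delta')=(\Gamma,\Gamma'\Rightarrow\Delta,\Delta')$. Meta-formulas are built by the connectives from atoms and formula variables; $V(\phi)$ is the set of atoms and formula variables occurring in $\phi$. A rule consists of finitely many premises and a conclusion, which are meta-sequents, i.e. sequents built from meta-formulas and meta-multiset variables (contexts); in modal rules also $\Box\Gamma$ for a context $\Gamma$ occurs. An instance of a rule substitutes formulas for formula variables and finite multisets of formulas for contexts, so that all resulting sequents are single-conclusion. A rule is backward applicable to $S$ if some instance has conclusion $S$. A calculus is a set of rules; derivability is by proof trees. A rule is admissible in $H$ if the derivable sequents of $H$ are closed under its instances. **Rules.** Below, $\Pi_j,\Gamma_i,\Delta_i$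 are pairwise distinct contexts, barred letters are finite multisets of meta-formulas, $\phi$ is a meta-formula, blocks of premises with fixed first index may have any finite size, and all atoms and formula variables of the displayed meta-formulas of the premises belong to $V(\phi)$. - *Left semi-analytic* ($m\ge 0$, $n\ge 1$): from $\Pi_j,\bar\psi_{js}\Rightarrow\bar\theta_{js}$ (all $j\le m$, all $s$) and $\Gamma_i,\bar\phi_{ir}\Rightarrow\Delta_i$ (all $i\le n$, all $r$) infer $\Pi_1,\dots,\Pi_m,\Gamma_1,\dots,\Gamma_n,\phi\Rightarrow\Delta_1,\dots,\Delta_n$. - *Right semi-analytic* ($n\ge0$): from $\Gamma_i,\bar\phi_{ir}\Rightarrow\bar\psi_{ir}$ (all $i\le n$, all $r$) infer $\Gamma_1,\dots,\Gamma_n\Rightarrow\phi$. - *Modal semi-analytic*: $(K)$: from $\Gamma\Rightarrow\phi$ infer $\Box\Gamma\Rightarrow\Box\phi$, with $\phi$ a formula variable; $(D)$: from $\Gamma\Rightarrow$ infer $\Box\Gamma\Rightarrow$, where $\Gamma$ is non-empty. - *Semi-analytic* means left, right or modal semi-analytic. - *Context-sharing semi-analytic* ($n\ge1$): from $\Gamma_i,\bar\psi_{is}\Rightarrow\bar\theta_{is}$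 and $\Gamma_i,\bar\phi_{ir}\Rightarrow\Delta_i$ (all $i\le n$, all $s$, $r$) infer $\Gamma_1,\dots,\Gamma_n,\phi\Rightarrow\Delta_1,\dots,\Delta_n$. **$\mathbf{FL_e}$** is the single-conclusion calculus with the axioms $\phi\Rightarrow\phi$; $\Gamma\Rightarrow\top$; $\Gamma,\bot\Rightarrow\Delta$; $\Rightarrow1$; $0\Rightarrow$ and the usual left and right rules for $\wedge,\vee,*,\to$ (multiplicative for $*$ and for left $\to$), the left rule for $1$ and the right rule for $0$. *$H$ extends $\mathbf{FL_e}$* means that all axioms and rules of $\mathbf{FL_e}$ are admissible in $H$. **Axiomatic extension.** $H$ is the axiomatic extension of $G$ by a set $R$ of rules if $H$ consists of all sequents derivable in $G$, taken as axioms, together with the rules in $R$. **Terminating.** $H$ is terminating if for each sequent $S$ only finitely many rules of $H$ are backward applicable to $S$, and there is a well-founded order on sequents in which the following are less than $S$: the premises of every rule instance of $H$ with conclusion $S$; every proper subsequent of $S$; and every $(\Gamma,\Pi\Rightarrow\Delta,\Lambda)$ such that $S=(\Gamma,\Box\Pi\Rightarrow\Delta,\Box\Lambda)$ and $\Pi\cup\Lambda\neq\emptyset$.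 **Weak uniform interpolation.** $G$ has weak $H$-uniform interpolation if for every atom $p$ there are assignments $S\mapsto I(S)$ (for all sequents $S$) and $T\mapsto J(T)$ (for all sequents $T$ with $T^s=\emptyset$) of $p$-free formulas (formulas in which $p$ does not occur) such that 1. $H\vdash S\cdot(I(S)\Rightarrow)$; 2. for every multiset $\Gamma$ of $p$-free formulas, if $G\vdash S\cdot(\Gamma\Rightarrow)$ then $H\vdash J(\tilde S),\Gamma\Rightarrow I(S)$; 3. $H\vdash T\cdot(\Rightarrow J(T))$; 4. for all multisets $\Gamma,\Delta$ of $p$-free formulas, if $G\vdash T\cdot(\Gamma\Rightarrow\Delta)$ then $H\vdash J(T),\Gamma\Rightarrow\Delta$. **Theorem.** Let $G$ and $H$ be sequent calculi such that $H$ extends $\mathbf{FL_e}$ and the following rules are admissible in $H$: left weakening (from $\Gamma\Rightarrow\Delta$ infer $\Gamma,\phi\Rightarrow\Delta$), right weakening (from $\Gamma\Rightarrow$ infer $\Gamma\Rightarrow\phi$), and context-sharing left implication (from $\Gamma\Rightarrow\phi$ and $\Gamma,\psi\Rightarrow\Delta$ infer $\Gamma,\phi\to\psi\Rightarrow\Delta$).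 Suppose that $H$ is terminating and is the axiomatic extension of $G$ by a set $R$ of rules each of which is semi-analytic or context-sharing semi-analytic, where $R$ contains $(K)$ if it contains $(D)$. If $G$ has weak $H$-uniform interpolation, then $H$ has weak $H$-uniform interpolation. -/

import Mathlib

universe u v

namespace UniversalProofTheory

/-- A propositional language: connectives with arities, among them the connectives of `FL_e`,
and possibly a modality. The distinguished connectives are not required to be distinct symbols
(in the usual language of intuitionistic logic fusion is conjunction, `1` is `⊤`, `0` is `⊥`). -/
structure PropLang where
  Conn : ℕ → Type u
  and : Conn 2
  or : Conn 2
  imp : Conn 2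
  fus : Conn 2
  zero : Conn 0
  one : Conn 0
  top : Conn 0
  bot : Conn 0
  box : Option (Conn 1)

/-- Formulas over a type `α` of atomic formulas. -/
inductive Form (L : PropLang.{u}) (α : Type v) : Type (max u v)
  | atom (a : α) : Form L α
  | app {n : ℕ} (c : L.Conn n) (args : Fin n → Form L α) : Form L α

namespace Form

variable {L : PropLang.{u}} {α β : Type v}

/-- The set `V(φ)` of atoms occurring in a formula. -/
def atoms : Form L α → Set α
  | atom a => {a}
  | app _ args => {a | ∃ i, a ∈ (args i).atoms}

/-- `φ` is `p`-free. -/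
def Free (p : α) (φ : Form L α) : Prop := p ∉ φ.atoms

/-- Simultaneous substitution of formulas for atoms. -/
def subst (σ : α → Form L β) : Form L α → Form L β
  | atom a => σ a
  | app c args => app c fun i => (args i).subst σ

/-- Application of a nullary, unary, binary connective. -/
def app0 (c : L.Conn 0) : Form L α := app c ![]
def app1 (c : L.Conn 1) (φ : Form L α) : Form L α := app c ![φ]
def app2 (c : L.Conn 2) (φ ψ : Form L α) : Form L α := app c ![φ, ψ]

end Form

/-- A sequent `Γ ⇒ Δ`. -/
@[ext]
structure Sequent (L : PropLang.{u}) (α : Type v) where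
  ant : Multiset (Form L α)
  suc : Multiset (Form L α)

namespace Sequent

variable {L : PropLang.{u}} {α : Type v}

/-- Single-conclusion sequents: `|Δ| ≤ 1`. -/
def Single (S : Sequent L α) : Prop := Multiset.card S.suc ≤ 1

/-- `S · T = (Sᵃ, Tᵃ ⇒ Sˢ, Tˢ)`. -/
instance : Mul (Sequent L α) := ⟨fun S T => ⟨S.ant + T.ant, S.suc + T.suc⟩⟩

/-- `S̃ = (Sᵃ ⇒ )`. -/
def tilde (S : Sequent L α) : Sequent L α := ⟨S.ant, 0⟩

/-- `S` is a subsequent of `T`. -/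
def Sub (S T : Sequent L α) : Prop := S.ant ≤ T.ant ∧ S.suc ≤ T.suc

end Sequent

/-! ### Meta-language, rules, calculi -/

/-- Meta-formulas: built from atomic formulas (`Sum.inl a`) and formula variables (`Sum.inr k`). -/
abbrev MetaForm (L : PropLang.{u}) (α : Type v) := Form L (α ⊕ ℕ)

/-- Members of meta-multisets: a meta-formula, a meta-multiset variable (context) `X`, or, as
needed for modal rules, `cX`: a context with a unary connective `c` put on each of its members. -/
inductive MetaItem (L : PropLang.{u}) (α : Type v) : Type (max u v)
  | fm (φ : MetaForm L α) : MetaItem L α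
  | ctx (X : ℕ) : MetaItem L α
  | opCtx (c : L.Conn 1) (X : ℕ) : MetaItem L α

structure MetaSequent (L : PropLang.{u}) (α : Type v) where
  ant : Multiset (MetaItem L α)
  suc : Multiset (MetaItem L α)

/-- A substitution: formulas for formula variables, multisets of formulas for contexts. -/
structure MetaSubst (L : PropLang.{u}) (α : Type v) where
  form : ℕ → Form L α
  ctx : ℕ → Multiset (Form L α)

section

variable {L : PropLang.{u}} {α : Type v}

def MetaForm.inst (σ : MetaSubst L α) (φ : MetaForm L α) : Form L α :=
  Form.subst (Sum.elim Form.atom σ.form) φ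

def MetaItem.inst (σ : MetaSubst L α) : MetaItem L α → Multiset (Form L α)
  | .fm φ => {MetaForm.inst σ φ}
  | .ctx X => σ.ctx X
  | .opCtx c X => (σ.ctx X).map (Form.app1 c)

def MetaSequent.inst (σ : MetaSubst L α) (S : MetaSequent L α) : Sequent L α :=
  ⟨S.ant.bind (MetaItem.inst σ), S.suc.bind (MetaItem.inst σ)⟩

end

/-- A rule: finitely many premises and a conclusion, all of them meta-sequents. -/
structure Rule (L : PropLang.{u}) (α : Type v) where
  prems : Multiset (MetaSequent L α)
  concl : MetaSequent L α

/-- A sequent calculus is a set of rules. -/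
abbrev Calculus (L : PropLang.{u}) (α : Type v) := Set (Rule L α)

section

variable {L : PropLang.{u}} {α : Type v}

/-- `σ` yields an instance of `r` in the single-conclusion setting: all the sequents of the
instance have at most one formula in the succedent. -/
def Rule.Valid (r : Rule L α) (σ : MetaSubst L α) : Prop :=
  (r.concl.inst σ).Single ∧ ∀ P ∈ r.prems, (P.inst σ).Single

/-- `r` is backward applicable to `S`. -/
def Rule.BackwardApplicable (r : Rule L α) (S : Sequent L α) : Prop :=
  ∃ σ, r.Valid σ ∧ r.concl.inst σ = S

/-- Derivability by proof trees of (single-conclusion) sequents. -/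
inductive Calculus.Derivable (G : Calculus L α) : Sequent L α → Prop
  | step (r : Rule L α) (hr : r ∈ G) (σ : MetaSubst L α) (hσ : r.Valid σ)
      (h : ∀ P ∈ r.prems, Calculus.Derivable G (P.inst σ)) :
      Calculus.Derivable G (r.concl.inst σ)

/-- `r` is admissible in `H`: the derivable sequents of `H` are closed under `r`. -/
def Calculus.Admits (H : Calculus L α) (r : Rule L α) : Prop :=
  ∀ σ, r.Valid σ → (∀ P ∈ r.prems, H.Derivable (P.inst σ)) → H.Derivable (r.concl.inst σ)

/-- `H` extends `G`: all axioms and rules of `G` are admissible in `H`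
(in particular, every sequent derivable in `G` is derivable in `H`). -/
def Calculus.Extends (H G : Calculus L α) : Prop := ∀ r ∈ G, H.Admits r

/-- A concrete sequent, as an axiom (a rule without premises and without variables). -/
def Rule.ofSequent (S : Sequent L α) : Rule L α where
  prems := 0
  concl := ⟨S.ant.map fun φ => .fm (φ.subst fun a => .atom (.inl a)),
    S.suc.map fun φ => .fm (φ.subst fun a => .atom (.inl a))⟩

/-- `H` is the axiomatic extension of `G` by the rules `R`: the provable sequents of `G` are the
axioms of `H`, to which `H` adds the rules in `R`. -/
def Calculus.IsAxiomaticExtension (H G R : Calculus L α) : Prop :=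
  H = {r | ∃ S, G.Derivable S ∧ r = Rule.ofSequent S} ∪ R

/-! ### The calculus `FL_e` and further structural rules -/

/-- Abbreviations: the formula variable number `k`, and the context number `k`. -/
def fv (k : ℕ) : MetaForm L α := .atom (.inr k)
def mf (φ : MetaForm L α) : MetaItem L α := .fm φ
def mc (k : ℕ) : MetaItem L α := .ctx k

/-- The single-conclusion calculus `FL_e`. Formula variables: `φ = fv 0`, `ψ = fv 1`. Contexts:
`Γ = mc 0`, `Σ = mc 1`, `Δ = mc 2`. -/
inductive FLe : Rule L α → Prop
  -- φ ⇒ φ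
  | id : FLe ⟨0, ⟨{mf (fv 0)}, {mf (fv 0)}⟩⟩
  -- Γ ⇒ ⊤
  | topR : FLe ⟨0, ⟨{mc 0}, {mf (.app0 L.top)}⟩⟩
  -- Γ, ⊥ ⇒ Δ
  | botL : FLe ⟨0, ⟨{mc 0, mf (.app0 L.bot)}, {mc 2}⟩⟩
  -- ⇒ 1
  | oneR : FLe ⟨0, ⟨0, {mf (.app0 L.one)}⟩⟩
  -- 0 ⇒
  | zeroL : FLe ⟨0, ⟨{mf (.app0 L.zero)}, 0⟩⟩
  -- Γ ⇒ Δ / Γ, 1 ⇒ Δ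
  | oneL : FLe ⟨{⟨{mc 0}, {mc 2}⟩}, ⟨{mc 0, mf (.app0 L.one)}, {mc 2}⟩⟩
  -- Γ ⇒ / Γ ⇒ 0
  | zeroR : FLe ⟨{⟨{mc 0}, 0⟩}, ⟨{mc 0}, {mf (.app0 L.zero)}⟩⟩
  -- Γ, φ ⇒ Δ / Γ, φ ∧ ψ ⇒ Δ
  | andL₁ : FLe ⟨{⟨{mc 0, mf (fv 0)}, {mc 2}⟩},
      ⟨{mc 0, mf (.app2 L.and (fv 0) (fv 1))}, {mc 2}⟩⟩
  -- Γ, ψ ⇒ Δ / Γ, φ ∧ ψ ⇒ Δ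
  | andL₂ : FLe ⟨{⟨{mc 0, mf (fv 1)}, {mc 2}⟩},
      ⟨{mc 0, mf (.app2 L.and (fv 0) (fv 1))}, {mc 2}⟩⟩
  -- Γ ⇒ φ and Γ ⇒ ψ / Γ ⇒ φ ∧ ψ
  | andR : FLe ⟨{⟨{mc 0}, {mf (fv 0)}⟩, ⟨{mc 0}, {mf (fv 1)}⟩},
      ⟨{mc 0}, {mf (.app2 L.and (fv 0) (fv 1))}⟩⟩
  -- Γ, φ ⇒ Δ and Γ, ψ ⇒ Δ / Γ, φ ∨ ψ ⇒ Δ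
  | orL : FLe ⟨{⟨{mc 0, mf (fv 0)}, {mc 2}⟩, ⟨{mc 0, mf (fv 1)}, {mc 2}⟩},
      ⟨{mc 0, mf (.app2 L.or (fv 0) (fv 1))}, {mc 2}⟩⟩
  -- Γ ⇒ φ / Γ ⇒ φ ∨ ψ
  | orR₁ : FLe ⟨{⟨{mc 0}, {mf (fv 0)}⟩}, ⟨{mc 0}, {mf (.app2 L.or (fv 0) (fv 1))}⟩⟩
  -- Γ ⇒ ψ / Γ ⇒ φ ∨ ψ
  | orR₂ : FLe ⟨{⟨{mc 0}, {mf (fv 1)}⟩}, ⟨{mc 0}, {mf (.app2 L.or (fv 0) (fv 1))}⟩⟩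
  -- Γ, φ, ψ ⇒ Δ / Γ, φ * ψ ⇒ Δ
  | fusL : FLe ⟨{⟨{mc 0, mf (fv 0), mf (fv 1)}, {mc 2}⟩},
      ⟨{mc 0, mf (.app2 L.fus (fv 0) (fv 1))}, {mc 2}⟩⟩
  -- Γ ⇒ φ and Σ ⇒ ψ / Γ, Σ ⇒ φ * ψ
  | fusR : FLe ⟨{⟨{mc 0}, {mf (fv 0)}⟩, ⟨{mc 1}, {mf (fv 1)}⟩},
      ⟨{mc 0, mc 1}, {mf (.app2 L.fus (fv 0) (fv 1))}⟩⟩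
  -- Γ ⇒ φ and Σ, ψ ⇒ Δ / Γ, Σ, φ → ψ ⇒ Δ
  | impL : FLe ⟨{⟨{mc 0}, {mf (fv 0)}⟩, ⟨{mc 1, mf (fv 1)}, {mc 2}⟩},
      ⟨{mc 0, mc 1, mf (.app2 L.imp (fv 0) (fv 1))}, {mc 2}⟩⟩
  -- Γ, φ ⇒ ψ / Γ ⇒ φ → ψ
  | impR : FLe ⟨{⟨{mc 0, mf (fv 0)}, {mf (fv 1)}⟩},
      ⟨{mc 0}, {mf (.app2 L.imp (fv 0) (fv 1))}⟩⟩

variable (L α) in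
/-- `FL_e` as a calculus. -/
def calculusFLe : Calculus L α := {r | FLe r}

variable (L α) in
/-- Left weakening: `Γ ⇒ Δ / Γ, φ ⇒ Δ`. -/
def leftWeakening : Rule L α :=
  ⟨{⟨{mc 0}, {mc 2}⟩}, ⟨{mc 0, mf (fv 0)}, {mc 2}⟩⟩

variable (L α) in
/-- Right weakening (single-conclusion): `Γ ⇒ / Γ ⇒ φ`. -/
def rightWeakening : Rule L α :=
  ⟨{⟨{mc 0}, 0⟩}, ⟨{mc 0}, {mf (fv 0)}⟩⟩

variable (L α) in
/-- Context-sharing left implication: `Γ ⇒ φ` and `Γ, ψ ⇒ Δ / Γ, φ → ψ ⇒ Δ`. -/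
def contextSharingImpL : Rule L α :=
  ⟨{⟨{mc 0}, {mf (fv 0)}⟩, ⟨{mc 0, mf (fv 1)}, {mc 2}⟩},
    ⟨{mc 0, mf (.app2 L.imp (fv 0) (fv 1))}, {mc 2}⟩⟩

/-! ### Semi-analytic rules -/

/-- The meta-multiset of the context variables `X 0, …, X (n - 1)`. -/
def ctxs {n : ℕ} (X : Fin n → ℕ) : Multiset (MetaItem L α) :=
  Finset.univ.val.map fun i => MetaItem.ctx (X i)

/-- A multiset of meta-formulas as a meta-multiset. -/
def fms (Φ : Multiset (MetaForm L α)) : Multiset (MetaItem L α) := Φ.map MetaItem.fm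

/-- `V(Φ) ⊆ V(φ)` for a multiset `Φ` of meta-formulas. -/
def Occ (Φ : Multiset (MetaForm L α)) (φ : MetaForm L α) : Prop :=
  ∀ χ ∈ Φ, χ.atoms ⊆ φ.atoms

/-- Left semi-analytic rules:
`⟨⟨Π_j, ψ̄_js ⇒ θ̄_js⟩_s⟩_j` and `⟨⟨Γ_i, φ̄_ir ⇒ Δ_i⟩_r⟩_i` yield `Π_1,…,Π_m, Γ_1,…,Γ_n, φ ⇒ Δ_1,…,Δ_n`.
Here `T j` lists the pairs `(ψ̄_js, θ̄_js)` and `S i` lists the `φ̄_ir`; the context variables are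
pairwise distinct, and at least one context variable is present in the succedent. -/
def Rule.IsLeftSemiAnalytic (r : Rule L α) : Prop :=
  ∃ (m n : ℕ) (Pi : Fin m → ℕ) (Ga De : Fin n → ℕ)
    (T : Fin m → Multiset (Multiset (MetaForm L α) × Multiset (MetaForm L α)))
    (S : Fin n → Multiset (Multiset (MetaForm L α))) (φ : MetaForm L α),
    0 < n ∧ Function.Injective (Sum.elim Pi (Sum.elim Ga De)) ∧
    (∀ j, ∀ t ∈ T j, Occ t.1 φ ∧ Occ t.2 φ) ∧ (∀ i, ∀ Φ ∈ S i, Occ Φ φ) ∧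
    r.prems =
      (∑ j, (T j).map fun t => ⟨.ctx (Pi j) ::ₘ fms t.1, fms t.2⟩) +
      (∑ i, (S i).map fun Φ => ⟨.ctx (Ga i) ::ₘ fms Φ, {.ctx (De i)}⟩) ∧
    r.concl = ⟨ctxs Pi + ctxs Ga + {.fm φ}, ctxs De⟩

/-- Right semi-analytic rules:
`⟨⟨Γ_i, φ̄_ir ⇒ ψ̄_ir⟩_r⟩_i` yield `Γ_1,…,Γ_n ⇒ φ`, where `T i` lists the pairs `(φ̄_ir, ψ̄_ir)`. -/
def Rule.IsRightSemiAnalytic (r : Rule L α) : Prop :=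
  ∃ (n : ℕ) (Ga : Fin n → ℕ)
    (T : Fin n → Multiset (Multiset (MetaForm L α) × Multiset (MetaForm L α)))
    (φ : MetaForm L α),
    Function.Injective Ga ∧ (∀ i, ∀ t ∈ T i, Occ t.1 φ ∧ Occ t.2 φ) ∧
    r.prems = (∑ i, (T i).map fun t => ⟨.ctx (Ga i) ::ₘ fms t.1, fms t.2⟩) ∧
    r.concl = ⟨ctxs Ga, {.fm φ}⟩

/-- Context-sharing semi-analytic rules:
`⟨⟨Γ_i, ψ̄_is ⇒ θ̄_is⟩_s⟩_i` and `⟨⟨Γ_i, φ̄_ir ⇒ Δ_i⟩_r⟩_i` yield `Γ_1,…,Γ_n, φ ⇒ Δ_1,…,Δ_n`. -/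
def Rule.IsContextSharingSemiAnalytic (r : Rule L α) : Prop :=
  ∃ (n : ℕ) (Ga De : Fin n → ℕ)
    (T : Fin n → Multiset (Multiset (MetaForm L α) × Multiset (MetaForm L α)))
    (S : Fin n → Multiset (Multiset (MetaForm L α))) (φ : MetaForm L α),
    0 < n ∧ Function.Injective (Sum.elim Ga De) ∧
    (∀ i, ∀ t ∈ T i, Occ t.1 φ ∧ Occ t.2 φ) ∧ (∀ i, ∀ Φ ∈ S i, Occ Φ φ) ∧
    r.prems =
      (∑ i, (T i).map fun t => ⟨.ctx (Ga i) ::ₘ fms t.1, fms t.2⟩) +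
      (∑ i, (S i).map fun Φ => ⟨.ctx (Ga i) ::ₘ fms Φ, {.ctx (De i)}⟩) ∧
    r.concl = ⟨ctxs Ga + {.fm φ}, ctxs De⟩

/-- The modal rule (K): `Γ ⇒ φ / □Γ ⇒ □φ`. -/
def Rule.IsK (r : Rule L α) : Prop :=
  ∃ b ∈ L.box, ∃ X k : ℕ,
    r = ⟨{⟨{.ctx X}, {.fm (fv k)}⟩}, ⟨{.opCtx b X}, {.fm (.app1 b (fv k))}⟩⟩

/-- The modal rule (D): `Γ ⇒ / □Γ ⇒ `, for non-empty `Γ`, which is written here as `Γ, φ`.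
(For empty `Γ` the rule would be the idle step from the empty sequent to itself, which changes
no derivable sequent but is not allowed in a terminating calculus.) -/
def Rule.IsD (r : Rule L α) : Prop :=
  ∃ b ∈ L.box, ∃ X k : ℕ,
    r = ⟨{⟨{.ctx X, .fm (fv k)}, 0⟩}, ⟨{.opCtx b X, .fm (.app1 b (fv k))}, 0⟩⟩

/-- Semi-analytic rules: left, right, or modal. -/
def Rule.IsSemiAnalytic (r : Rule L α) : Prop :=
  r.IsLeftSemiAnalytic ∨ r.IsRightSemiAnalytic ∨ r.IsK ∨ r.IsD

/-- All members of `R` are semi-analytic or context-sharing semi-analytic rules; moreover, as is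
always required of the modal rules, (K) is present whenever (D) is. -/
def Calculus.ConsistsOfSemiAnalyticRules (R : Calculus L α) : Prop :=
  (∀ r ∈ R, r.IsSemiAnalytic ∨ r.IsContextSharingSemiAnalytic) ∧
  ((∃ r ∈ R, r.IsD) → ∃ r ∈ R, r.IsK)

/-! ### Terminating calculi and weak uniform interpolation -/

/-- Terminating calculi: only finitely many rules are backward applicable to a given sequent, and
there is a well-founded order in which the following are less than `S`: the premises of every rule
instance with conclusion `S`; the proper subsequents of `S`; and `(Γ, P ⇒ Δ, Λ)` if `S` is
`(Γ, □P ⇒ Δ, □Λ)` with `P, Λ` not both empty. -/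
def Calculus.Terminating (H : Calculus L α) : Prop :=
  (∀ S : Sequent L α, S.Single → {r ∈ H | r.BackwardApplicable S}.Finite) ∧
  ∃ lt : Sequent L α → Sequent L α → Prop, WellFounded lt ∧
    (∀ r ∈ H, ∀ σ, r.Valid σ → ∀ P ∈ r.prems, lt (P.inst σ) (r.concl.inst σ)) ∧
    (∀ S T : Sequent L α, S.Single → T.Sub S → T ≠ S → lt T S) ∧
    (∀ b ∈ L.box, ∀ Γ P Δ Λ : Multiset (Form L α), P + Λ ≠ 0 →
      Sequent.Single ⟨Γ + P.map (Form.app1 b), Δ + Λ.map (Form.app1 b)⟩ →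
      lt ⟨Γ + P, Δ + Λ⟩ ⟨Γ + P.map (Form.app1 b), Δ + Λ.map (Form.app1 b)⟩)

/-- `G` has weak `H`-uniform interpolation (single-conclusion). For every atom `p`, `I` assigns to
sequents `S` and `J` to sequents `T` with empty succedent `p`-free formulas satisfying
(i), (ii'), (iii), (iv). -/
def Calculus.HasWeakUniformInterpolation (G H : Calculus L α) : Prop :=
  ∀ p : α, ∃ I J : Sequent L α → Form L α,
    (∀ S : Sequent L α, S.Single →
      (I S).Free p ∧
      H.Derivable (S * ⟨{I S}, 0⟩) ∧
      ∀ Γ : Multiset (Form L α), (∀ χ ∈ Γ, χ.Free p) →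
        G.Derivable (S * ⟨Γ, 0⟩) → H.Derivable ⟨J S.tilde ::ₘ Γ, {I S}⟩) ∧
    (∀ T : Sequent L α, T.suc = 0 →
      (J T).Free p ∧
      H.Derivable (T * ⟨0, {J T}⟩) ∧
      ∀ Γ Δ : Multiset (Form L α), (∀ χ ∈ Γ, χ.Free p) → (∀ χ ∈ Δ, χ.Free p) →
        G.Derivable (T * ⟨Γ, Δ⟩) → H.Derivable ⟨J T ::ₘ Γ, Δ⟩)

end

end UniversalProofTheory

/-! The interpolants of `H` are defined by recursion along the termination order and read off from
backward proof search. The left interpolant of `M ⇒` is a conjunction of everything that `M` is seen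
to prove: what `G` provides, fusions of left interpolants of the parts of `M`, and one formula for
each way of ending a proof with a left rule or (K). The right interpolant of `S` is an implication
from the left interpolant of `S̃` to a disjunction, with one disjunct for each way of obtaining `S`
as a conclusion. Termination makes both families finite: finitely many rules apply, the occurrence
condition lets the principal formula determine the other formulas of an instance, and a multiset
splits in finitely many ways.

Soundness (`sound`) goes by induction on the order: each rule is applied again with the interpolants
of the premises added to its contexts. Context-sharing left implication handles the outer
implication, since the antecedent of `S` proves its left interpolant and, together with the
disjunction, proves the succedent.

Completeness (`interpolates_of_derivable`) goes by induction on derivations in `H`, for all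
partitions of the derived sequent into a `p`-free part and the rest. If the principal formula lies
outside the `p`-free part, the disjunct or conjunct made for that rule applies. If it lies in the
`p`-free part, the occurrence condition makes the formulas of the premises `p`-free as well, and the
rule is applied again to premises in which left interpolants have replaced the rest of their
contexts; `leftCtx_sum` and `leftCtx_add` then merge these interpolants into one. Cut is not assumed
for `H`, which explains the shape of the formulas and the special treatment of the empty antecedent.
-/

namespace UniversalProofTheory

variable {L : PropLang.{u}} {α β : Type v}

/-! ### Substitution and occurrence of atoms -/

namespace Form

@[simp] theorem subst_app0 (σ : α → Form L β) (c : L.Conn 0) :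
    (app0 c : Form L α).subst σ = app0 c := by
  simp only [app0, subst]; congr 1; exact Subsingleton.elim _ _

@[simp] theorem subst_app1 (σ : α → Form L β) (c : L.Conn 1) (φ : Form L α) :
    (app1 c φ).subst σ = app1 c (φ.subst σ) := by
  simp only [app1, subst]; congr 1; funext i; fin_cases i; rfl

@[simp] theorem subst_app2 (σ : α → Form L β) (c : L.Conn 2) (φ ψ : Form L α) :
    (app2 c φ ψ).subst σ = app2 c (φ.subst σ) (ψ.subst σ) := by
  simp only [app2, subst]; congr 1; funext i; fin_cases i <;> rfl

theorem app1_injective (c : L.Conn 1) : Function.Injective (app1 c : Form L α → Form L α) := by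
  intro φ ψ h
  simp only [app1, app.injEq, heq_eq_eq, true_and] at h
  simpa using congrFun h 0

@[simp] theorem free_app0 (p : α) (c : L.Conn 0) : (app0 c : Form L α).Free p := by
  simp [Free, app0, atoms]

@[simp] theorem free_app1 {p : α} {c : L.Conn 1} {φ : Form L α} :
    (app1 c φ).Free p ↔ φ.Free p := by
  simp [Free, app1, atoms]

@[simp] theorem free_app2 {p : α} {c : L.Conn 2} {φ ψ : Form L α} :
    (app2 c φ ψ).Free p ↔ φ.Free p ∧ ψ.Free p := by
  simp [Free, app2, atoms, Fin.exists_fin_two]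

theorem subst_congr {σ τ : α → Form L β} {φ : Form L α} (h : ∀ a ∈ φ.atoms, σ a = τ a) :
    φ.subst σ = φ.subst τ := by
  induction φ with
  | atom a => exact h a rfl
  | app c args ih =>
    simp only [subst]; congr 1; funext i
    exact ih i fun a ha => h a ⟨i, ha⟩

/-- This is what the condition on `V(φ)` rests on: the instance of the principal formula fixes the
substitution on `V(φ)`, hence all displayed formulas of the premises. -/
theorem eqOn_atoms_of_subst_eq {σ τ : α → Form L β} {φ : Form L α}
    (h : φ.subst σ = φ.subst τ) : ∀ a ∈ φ.atoms, σ a = τ a := by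
  induction φ with
  | atom a => rintro b rfl; exact h
  | app c args ih =>
    simp only [subst, app.injEq, heq_eq_eq, true_and] at h
    rintro a ⟨i, ha⟩
    exact ih i (congrFun h i) a ha

theorem mem_atoms_subst {σ : α → Form L β} {φ : Form L α} {b : β} :
    b ∈ (φ.subst σ).atoms ↔ ∃ a ∈ φ.atoms, b ∈ (σ a).atoms := by
  induction φ with
  | atom a => simp [subst, atoms]
  | app c args ih =>
    simp only [subst, atoms, Set.mem_ofPred_eq, ih]
    constructor
    · rintro ⟨i, a, h, h'⟩; exact ⟨a, ⟨i, h⟩, h'⟩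
    · rintro ⟨a, ⟨i, h⟩, h'⟩; exact ⟨i, a, h, h'⟩

theorem subst_atom_subst (σ : β → Form L α) (e : α → β) (h : ∀ a, σ (e a) = atom a)
    (φ : Form L α) : (φ.subst fun a => atom (e a)).subst σ = φ := by
  induction φ with
  | atom a => exact h a
  | app c args ih => simp only [subst]; congr 1; funext i; exact ih i

end Form

/-! ### Derived rules of `H` -/

/-- The substitution with the given values at the formula variables `0`, `1` and the contexts
`0`, `1`, `2`. -/
def MetaSubst.ofValues (φ ψ : Form L α) (Γ Θ Δ : Multiset (Form L α)) : MetaSubst L α where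
  form := fun k => match k with
    | 0 => φ
    | _ => ψ
  ctx := fun k => match k with
    | 0 => Γ
    | 1 => Θ
    | _ => Δ

theorem Calculus.Derivable.single {H : Calculus L α} {S : Sequent L α} (h : H.Derivable S) :
    S.Single := by
  cases h with
  | step r hr σ hσ h => exact hσ.1

@[simp] theorem MetaForm.inst_fv (σ : MetaSubst L α) (k : ℕ) :
    MetaForm.inst σ (fv k) = σ.form k := rfl

@[simp] theorem MetaForm.inst_app0 (σ : MetaSubst L α) (c : L.Conn 0) :
    MetaForm.inst σ (.app0 c) = .app0 c := Form.subst_app0 _ _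

@[simp] theorem MetaForm.inst_app1 (σ : MetaSubst L α) (c : L.Conn 1) (φ : MetaForm L α) :
    MetaForm.inst σ (.app1 c φ) = .app1 c (MetaForm.inst σ φ) := Form.subst_app1 _ _ _

@[simp] theorem MetaForm.inst_app2 (σ : MetaSubst L α) (c : L.Conn 2) (φ ψ : MetaForm L α) :
    MetaForm.inst σ (.app2 c φ ψ) = .app2 c (MetaForm.inst σ φ) (MetaForm.inst σ ψ) :=
  Form.subst_app2 _ _ _ _

/-- `H` extends `FL_e` and admits weakening and context-sharing left implication. -/
structure Calculus.IsIntuitionistic (H : Calculus L α) : Prop where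
  extends_FLe : H.Extends (calculusFLe L α)
  leftWeakening : H.Admits (leftWeakening L α)
  rightWeakening : H.Admits (rightWeakening L α)
  contextSharingImpL : H.Admits (contextSharingImpL L α)

namespace Calculus.IsIntuitionistic

variable {H : Calculus L α} (hH : H.IsIntuitionistic)
  {Γ Θ Δ : Multiset (Form L α)} {φ ψ : Form L α}

include hH

theorem weakL_one (h : H.Derivable ⟨Γ, Δ⟩) : H.Derivable ⟨Γ + {φ}, Δ⟩ := by
  have := hH.leftWeakening (.ofValues φ φ Γ Γ Δ)
  have hs := h.single
  simp_all [Rule.Valid, UniversalProofTheory.leftWeakening, MetaSequent.inst, MetaItem.inst, mf, mc,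
    MetaSubst.ofValues, Sequent.Single]

theorem weakL (Θ : Multiset (Form L α)) (h : H.Derivable ⟨Γ, Δ⟩) : H.Derivable ⟨Γ + Θ, Δ⟩ := by
  induction Θ using Multiset.induction_on with
  | empty => simpa using h
  | cons φ Θ ih =>
    rw [← Multiset.singleton_add, add_comm {φ} Θ, ← add_assoc]
    exact hH.weakL_one ih

theorem weakL_of_le (hle : Γ ≤ Θ) (h : H.Derivable ⟨Γ, Δ⟩) : H.Derivable ⟨Θ, Δ⟩ := by
  obtain ⟨Ξ, rfl⟩ := Multiset.le_iff_exists_add.1 hle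
  exact hH.weakL Ξ h

theorem weakR_one (h : H.Derivable ⟨Γ, 0⟩) : H.Derivable ⟨Γ, {φ}⟩ := by
  have := hH.rightWeakening (.ofValues φ φ Γ Γ Γ)
  have hs := h.single
  simp_all [Rule.Valid, UniversalProofTheory.rightWeakening, MetaSequent.inst, MetaItem.inst, mf,
    mc, MetaSubst.ofValues, Sequent.Single]

/-- In the absence of cut and contraction, this lets a single context both prove an interpolant and
be used beside another. -/
theorem impCS (h0 : H.Derivable ⟨Γ, {φ}⟩) (h1 : H.Derivable ⟨Γ + {ψ}, Δ⟩) :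
    H.Derivable ⟨Γ + {Form.app2 L.imp φ ψ}, Δ⟩ := by
  have := hH.contextSharingImpL (.ofValues φ ψ Γ 0 Δ)
  have hs0 := h0.single
  have hs1 := h1.single
  simp_all [Rule.Valid, UniversalProofTheory.contextSharingImpL, MetaSequent.inst, MetaItem.inst,
    mf, mc, MetaSubst.ofValues, Sequent.Single]

theorem topR :
    H.Derivable ⟨Γ, {Form.app0 L.top}⟩ := by
  have := hH.extends_FLe _ FLe.topR (.ofValues (.app0 L.top) (.app0 L.top) Γ 0 0)
  simp_all [Rule.Valid, MetaSequent.inst, MetaItem.inst, mf, mc,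
    MetaSubst.ofValues, Sequent.Single]

theorem oneR :
    H.Derivable ⟨0, {Form.app0 L.one}⟩ := by
  have := hH.extends_FLe _ FLe.oneR (.ofValues (.app0 L.one) (.app0 L.one) 0 0 0)
  simp_all [Rule.Valid, MetaSequent.inst, MetaItem.inst, mf,
    MetaSubst.ofValues, Sequent.Single]

theorem andL₁ (h0 : H.Derivable ⟨Γ + {φ}, Δ⟩) :
    H.Derivable ⟨Γ + {Form.app2 L.and φ ψ}, Δ⟩ := by
  have := hH.extends_FLe _ FLe.andL₁ (.ofValues φ ψ Γ 0 Δ)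
  have hs0 := h0.single
  simp_all [Rule.Valid, MetaSequent.inst, MetaItem.inst, mf, mc,
    MetaSubst.ofValues, Sequent.Single]

theorem andL₂ (h0 : H.Derivable ⟨Γ + {ψ}, Δ⟩) :
    H.Derivable ⟨Γ + {Form.app2 L.and φ ψ}, Δ⟩ := by
  have := hH.extends_FLe _ FLe.andL₂ (.ofValues φ ψ Γ 0 Δ)
  have hs0 := h0.single
  simp_all [Rule.Valid, MetaSequent.inst, MetaItem.inst, mf, mc,
    MetaSubst.ofValues, Sequent.Single]

theorem andR (h0 : H.Derivable ⟨Γ, {φ}⟩) (h1 : H.Derivable ⟨Γ, {ψ}⟩) :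
    H.Derivable ⟨Γ, {Form.app2 L.and φ ψ}⟩ := by
  have := hH.extends_FLe _ FLe.andR (.ofValues φ ψ Γ 0 0)
  have hs0 := h0.single
  have hs1 := h1.single
  simp_all [Rule.Valid, MetaSequent.inst, MetaItem.inst, mf, mc,
    MetaSubst.ofValues, Sequent.Single]

theorem orL (h0 : H.Derivable ⟨Γ + {φ}, Δ⟩) (h1 : H.Derivable ⟨Γ + {ψ}, Δ⟩) :
    H.Derivable ⟨Γ + {Form.app2 L.or φ ψ}, Δ⟩ := by
  have := hH.extends_FLe _ FLe.orL (.ofValues φ ψ Γ 0 Δ)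
  have hs0 := h0.single
  have hs1 := h1.single
  simp_all [Rule.Valid, MetaSequent.inst, MetaItem.inst, mf, mc,
    MetaSubst.ofValues, Sequent.Single]

theorem orR₁ (h0 : H.Derivable ⟨Γ, {φ}⟩) :
    H.Derivable ⟨Γ, {Form.app2 L.or φ ψ}⟩ := by
  have := hH.extends_FLe _ FLe.orR₁ (.ofValues φ ψ Γ 0 0)
  have hs0 := h0.single
  simp_all [Rule.Valid, MetaSequent.inst, MetaItem.inst, mf, mc,
    MetaSubst.ofValues, Sequent.Single]

theorem orR₂ (h0 : H.Derivable ⟨Γ, {ψ}⟩) :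
    H.Derivable ⟨Γ, {Form.app2 L.or φ ψ}⟩ := by
  have := hH.extends_FLe _ FLe.orR₂ (.ofValues φ ψ Γ 0 0)
  have hs0 := h0.single
  simp_all [Rule.Valid, MetaSequent.inst, MetaItem.inst, mf, mc,
    MetaSubst.ofValues, Sequent.Single]

theorem fusL (h0 : H.Derivable ⟨Γ + {φ, ψ}, Δ⟩) :
    H.Derivable ⟨Γ + {Form.app2 L.fus φ ψ}, Δ⟩ := by
  have := hH.extends_FLe _ FLe.fusL (.ofValues φ ψ Γ 0 Δ)
  have hs0 := h0.single
  simp_all [Rule.Valid, MetaSequent.inst, MetaItem.inst, mf, mc,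
    MetaSubst.ofValues, Sequent.Single]

theorem fusR (h0 : H.Derivable ⟨Γ, {φ}⟩) (h1 : H.Derivable ⟨Θ, {ψ}⟩) :
    H.Derivable ⟨Γ + Θ, {Form.app2 L.fus φ ψ}⟩ := by
  have := hH.extends_FLe _ FLe.fusR (.ofValues φ ψ Γ Θ 0)
  have hs0 := h0.single
  have hs1 := h1.single
  simp_all [Rule.Valid, MetaSequent.inst, MetaItem.inst, mf, mc,
    MetaSubst.ofValues, Sequent.Single]

theorem impL (h0 : H.Derivable ⟨Γ, {φ}⟩) (h1 : H.Derivable ⟨Θ + {ψ}, Δ⟩) :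
    H.Derivable ⟨Γ + Θ + {Form.app2 L.imp φ ψ}, Δ⟩ := by
  have := hH.extends_FLe _ FLe.impL (.ofValues φ ψ Γ Θ Δ)
  have hs0 := h0.single
  have hs1 := h1.single
  simp_all [Rule.Valid, add_assoc, MetaSequent.inst, MetaItem.inst, mf, mc,
    MetaSubst.ofValues, Sequent.Single]

theorem impR (h0 : H.Derivable ⟨Γ + {φ}, {ψ}⟩) :
    H.Derivable ⟨Γ, {Form.app2 L.imp φ ψ}⟩ := by
  have := hH.extends_FLe _ FLe.impR (.ofValues φ ψ Γ 0 0)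
  have hs0 := h0.single
  simp_all [Rule.Valid, MetaSequent.inst, MetaItem.inst, mf, mc,
    MetaSubst.ofValues, Sequent.Single]

theorem botL (hΔ : Multiset.card Δ ≤ 1) : H.Derivable ⟨Γ + {Form.app0 L.bot}, Δ⟩ := by
  have := hH.extends_FLe _ FLe.botL (.ofValues (.app0 L.bot) (.app0 L.bot) Γ 0 Δ)
  simp_all [Rule.Valid, MetaSequent.inst, MetaItem.inst, mf, mc,
    MetaSubst.ofValues, Sequent.Single]

theorem oneL (h : H.Derivable ⟨Γ, Δ⟩) : H.Derivable ⟨Γ + {Form.app0 L.one}, Δ⟩ :=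
  hH.weakL_one h

end Calculus.IsIntuitionistic

/-! ### Finite conjunctions, disjunctions and fusions -/

/-- Iterated conjunction. -/
def bigAnd : List (Form L α) → Form L α
  | [] => .app0 L.top
  | φ :: l => .app2 L.and φ (bigAnd l)

/-- Iterated disjunction. -/
def bigOr : List (Form L α) → Form L α
  | [] => .app0 L.bot
  | φ :: l => .app2 L.or φ (bigOr l)

/-- Iterated fusion. -/
def bigFus : List (Form L α) → Form L α
  | [] => .app0 L.one
  | φ :: l => .app2 L.fus φ (bigFus l)

theorem free_bigAnd {p : α} {l : List (Form L α)} (h : ∀ φ ∈ l, φ.Free p) : (bigAnd l).Free p := by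
  induction l <;> simp_all [bigAnd]

theorem free_bigOr {p : α} {l : List (Form L α)} (h : ∀ φ ∈ l, φ.Free p) : (bigOr l).Free p := by
  induction l <;> simp_all [bigOr]

theorem free_bigFus {p : α} {l : List (Form L α)} (h : ∀ φ ∈ l, φ.Free p) : (bigFus l).Free p := by
  induction l <;> simp_all [bigFus]

/-- The fusion of a finite family of formulas. -/
noncomputable def famFus {ι : Type} [Fintype ι] (a : ι → Form L α) : Form L α :=
  bigFus (Finset.univ.toList.map a)

theorem free_famFus {p : α} {ι : Type} [Fintype ι] {a : ι → Form L α} (h : ∀ i, (a i).Free p) :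
    (famFus a).Free p :=
  free_bigFus (by simpa using h)

/-- The conjunction of the members of a set of formulas (if it is finite). -/
noncomputable def setAnd (A : Set (Form L α)) : Form L α :=
  open scoped Classical in if h : A.Finite then bigAnd h.toFinset.toList else .app0 L.top

/-- The disjunction of the members of a set of formulas (if it is finite). -/
noncomputable def setOr (A : Set (Form L α)) : Form L α :=
  open scoped Classical in if h : A.Finite then bigOr h.toFinset.toList else .app0 L.bot

theorem free_setAnd {p : α} {A : Set (Form L α)} (h : ∀ φ ∈ A, φ.Free p) : (setAnd A).Free p := by
  unfold setAnd; split_ifs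
  · exact free_bigAnd (by simpa using h)
  · simp

theorem free_setOr {p : α} {A : Set (Form L α)} (h : ∀ φ ∈ A, φ.Free p) : (setOr A).Free p := by
  unfold setOr; split_ifs
  · exact free_bigOr (by simpa using h)
  · simp

namespace Calculus.IsIntuitionistic

variable {H : Calculus L α} (hH : H.IsIntuitionistic)
  {Γ Θ Δ : Multiset (Form L α)} {φ ψ : Form L α}

include hH

theorem bigAndR {l : List (Form L α)} (h : ∀ φ ∈ l, H.Derivable ⟨Γ, {φ}⟩) :
    H.Derivable ⟨Γ, {bigAnd l}⟩ := by
  induction l with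
  | nil => exact hH.topR
  | cons φ l ih => exact hH.andR (h φ (by simp)) (ih fun ψ hψ => h ψ (by simp [hψ]))

theorem bigAndL {l : List (Form L α)} (hφ : φ ∈ l) (h : H.Derivable ⟨Γ + {φ}, Δ⟩) :
    H.Derivable ⟨Γ + {bigAnd l}, Δ⟩ := by
  induction l with
  | nil => simp at hφ
  | cons ψ l ih =>
    rcases List.mem_cons.1 hφ with rfl | hφ
    · exact hH.andL₁ h
    · exact hH.andL₂ (ih hφ)

theorem bigOrR {l : List (Form L α)} (hφ : φ ∈ l) (h : H.Derivable ⟨Γ, {φ}⟩) :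
    H.Derivable ⟨Γ, {bigOr l}⟩ := by
  induction l with
  | nil => simp at hφ
  | cons ψ l ih =>
    rcases List.mem_cons.1 hφ with rfl | hφ
    · exact hH.orR₁ h
    · exact hH.orR₂ (ih hφ)

theorem bigOrL {l : List (Form L α)} (hΔ : Multiset.card Δ ≤ 1)
    (h : ∀ φ ∈ l, H.Derivable ⟨Γ + {φ}, Δ⟩) : H.Derivable ⟨Γ + {bigOr l}, Δ⟩ := by
  induction l with
  | nil => exact hH.botL hΔ
  | cons φ l ih => exact hH.orL (h φ (by simp)) (ih fun ψ hψ => h ψ (by simp [hψ]))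

theorem bigFusL {l : List (Form L α)} (h : H.Derivable ⟨Γ + ↑l, Δ⟩) :
    H.Derivable ⟨Γ + {bigFus l}, Δ⟩ := by
  induction l generalizing Γ with
  | nil => exact hH.oneL (by simpa using h)
  | cons φ l ih =>
    apply hH.fusL
    have : H.Derivable ⟨(Γ + {φ}) + {bigFus l}, Δ⟩ := ih (by
      rwa [add_assoc, Multiset.singleton_add, Multiset.cons_coe])
    rwa [add_assoc, Multiset.singleton_add] at this

theorem famFusL {ι : Type} [Fintype ι] {a : ι → Form L α}
    (h : H.Derivable ⟨Γ + ∑ i, {a i}, Δ⟩) : H.Derivable ⟨Γ + {famFus a}, Δ⟩ := by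
  apply hH.bigFusL
  rwa [← Multiset.map_coe, Finset.coe_toList, ← Multiset.sum_map_singleton
    (Multiset.map a _), Multiset.map_map]

theorem famFusR {ι : Type} [Fintype ι] {a : ι → Form L α} {X : ι → Multiset (Form L α)}
    (h : ∀ i, H.Derivable ⟨X i, {a i}⟩) : H.Derivable ⟨∑ i, X i, {famFus a}⟩ := by
  have key : ∀ l : List ι, H.Derivable ⟨(l.map X).sum, {bigFus (l.map a)}⟩ := by
    intro l
    induction l with
    | nil => exact hH.oneR
    | cons i l ih => simpa [bigFus] using hH.fusR (h i) ih
  simpa [famFus, Finset.sum_map_toList] using key Finset.univ.toList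

/-- Finiteness is not needed here, nor in `setOrL`, because the default for an infinite set is `⊤`,
respectively `⊥`. Soundness uses only these two; completeness uses the other two and needs
finiteness. -/
theorem setAndR {A : Set (Form L α)} (h : ∀ φ ∈ A, H.Derivable ⟨Γ, {φ}⟩) :
    H.Derivable ⟨Γ, {setAnd A}⟩ := by
  unfold setAnd; split_ifs
  · exact hH.bigAndR (by simpa using h)
  · exact hH.topR

theorem setAndL {A : Set (Form L α)} (hA : A.Finite) (hφ : φ ∈ A)
    (h : H.Derivable ⟨Γ + {φ}, Δ⟩) : H.Derivable ⟨Γ + {setAnd A}, Δ⟩ := by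
  rw [setAnd, dif_pos hA]
  exact hH.bigAndL (by simpa using hφ) h

theorem setOrR {A : Set (Form L α)} (hA : A.Finite) (hφ : φ ∈ A)
    (h : H.Derivable ⟨Γ, {φ}⟩) : H.Derivable ⟨Γ, {setOr A}⟩ := by
  rw [setOr, dif_pos hA]
  exact hH.bigOrR (by simpa using hφ) h

theorem setOrL {A : Set (Form L α)} (hΔ : Multiset.card Δ ≤ 1)
    (h : ∀ φ ∈ A, H.Derivable ⟨Γ + {φ}, Δ⟩) : H.Derivable ⟨Γ + {setOr A}, Δ⟩ := by
  unfold setOr; split_ifs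
  · exact hH.bigOrL hΔ (by simpa using h)
  · exact hH.botL hΔ

end Calculus.IsIntuitionistic

/-! ### Splitting multisets -/

/-- The common part of `C` and `A` is taken as large as possible, which forces the other three
parts. It serves to distribute a partition of the conclusion of a rule over the contexts of the
rule. -/
theorem exists_split_add {γ : Type*} {C D A B : Multiset γ} (h : C + D = A + B) :
    ∃ C₁ C₂ D₁ D₂, C = C₁ + C₂ ∧ D = D₁ + D₂ ∧ A = C₁ + D₁ ∧ B = C₂ + D₂ := by
  classical
  refine ⟨C ∩ A, C - A, A - C, D - (A - C), ?_, ?_, ?_, ?_⟩ <;>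
  · ext x
    have := congrArg (Multiset.count x) h
    simp only [Multiset.count_add, Multiset.count_inter, Multiset.count_sub] at *
    omega

theorem exists_split_sum {γ ι : Type*} (s : Finset ι) (X : ι → Multiset γ)
    {A B : Multiset γ} (h : ∑ i ∈ s, X i = A + B) :
    ∃ Y Z : ι → Multiset γ, (∀ i ∈ s, X i = Y i + Z i) ∧ A = ∑ i ∈ s, Y i ∧ B = ∑ i ∈ s, Z i := by
  classical
  induction s using Finset.induction_on generalizing A B with
  | empty =>
    simp only [Finset.sum_empty] at h
    obtain ⟨rfl, rfl⟩ := add_eq_zero.1 h.symm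
    exact ⟨0, 0, by simp⟩
  | insert i s hi ih =>
    rw [Finset.sum_insert hi] at h
    obtain ⟨C₁, C₂, D₁, D₂, hC, hD, hA, hB⟩ := exists_split_add h
    obtain ⟨Y, Z, hX, hY, hZ⟩ := ih hD
    refine ⟨Function.update Y i C₁, Function.update Z i C₂, ?_, ?_, ?_⟩
    · intro j hj
      rcases eq_or_ne j i with rfl | hji
      · simpa using hC
      · simpa [hji] using hX j ((Finset.mem_insert.1 hj).resolve_left hji)
    all_goals
      rw [Finset.sum_insert hi, Function.update_self, Finset.sum_congr rfl fun j hj =>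
        Function.update_of_ne (ne_of_mem_of_not_mem hj hi) _ _]
      simp [*]

theorem singleton_eq_add {γ : Type*} {a : γ} {A B : Multiset γ} (h : {a} = A + B) :
    (A = {a} ∧ B = 0) ∨ (A = 0 ∧ B = {a}) := by
  have hA : A ≤ {a} := h ▸ Multiset.le_add_right A B
  rcases Multiset.le_singleton.1 hA with rfl | rfl
  · right; simp [h]
  · left; exact ⟨rfl, left_eq_add.1 h⟩

theorem finite_of_forall_le {γ ι : Type*} [Finite ι] (M : Multiset γ)
    (s : Set (ι → Multiset γ)) (h : ∀ X ∈ s, ∀ i, X i ≤ M) : s.Finite := by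
  classical
  exact (Set.Finite.pi' fun _ => Set.finite_Iic M).subset h

/-- All formulas of a sequent are `p`-free. -/
def Sequent.Free (p : α) (S : Sequent L α) : Prop := ∀ χ ∈ S.ant + S.suc, χ.Free p

/-! ### Instances of rules with schematic contexts -/

/-- The formula part of an instance of a left or context-sharing semi-analytic rule in which the
succedent of the conclusion comes from one designated context. The blocks `T i` and `T₀` hold the
premises with a fixed succedent, `S` those whose succedent is the one of the conclusion. -/
structure LeftInst (L : PropLang.{u}) (α : Type v) where
  ι : Type
  [fin : Fintype ι]
  T : ι → List (Sequent L α)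
  T₀ : List (Sequent L α)
  S : List (Multiset (Form L α))
  φ : Form L α

/-- The formula part of an instance of a right semi-analytic rule. -/
structure RightInst (L : PropLang.{u}) (α : Type v) where
  ι : Type
  [fin : Fintype ι]
  T : ι → List (Sequent L α)
  φ : Form L α

attribute [instance] LeftInst.fin RightInst.fin

namespace LeftInst

def concl (ℓ : LeftInst L α) (X : ℓ.ι → Multiset (Form L α)) (X₀ Δ : Multiset (Form L α)) :
    Sequent L α :=
  ⟨∑ i, X i + X₀ + {ℓ.φ}, Δ⟩

def prems (ℓ : LeftInst L α) (X : ℓ.ι → Multiset (Form L α)) (X₀ Δ : Multiset (Form L α)) :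
    Set (Sequent L α) :=
  {Q | (∃ i, ∃ t ∈ ℓ.T i, Q = ⟨X i + t.ant, t.suc⟩) ∨ (∃ t ∈ ℓ.T₀, Q = ⟨X₀ + t.ant, t.suc⟩) ∨
    ∃ Φ ∈ ℓ.S, Q = ⟨X₀ + Φ, Δ⟩}

def Free (p : α) (ℓ : LeftInst L α) : Prop :=
  (∀ i, ∀ t ∈ ℓ.T i, t.Free p) ∧ (∀ t ∈ ℓ.T₀, t.Free p) ∧ ∀ Φ ∈ ℓ.S, ∀ χ ∈ Φ, χ.Free p

end LeftInst

namespace RightInst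

def concl (ℓ : RightInst L α) (X : ℓ.ι → Multiset (Form L α)) : Sequent L α := ⟨∑ i, X i, {ℓ.φ}⟩

def prems (ℓ : RightInst L α) (X : ℓ.ι → Multiset (Form L α)) : Set (Sequent L α) :=
  {Q | ∃ i, ∃ t ∈ ℓ.T i, Q = ⟨X i + t.ant, t.suc⟩}

def Free (p : α) (ℓ : RightInst L α) : Prop := ∀ i, ∀ t ∈ ℓ.T i, t.Free p

end RightInst

/-- Some instance of `r` has the set of premises `P` and the conclusion `C`. -/
def Rule.HasInst (r : Rule L α) (P : Set (Sequent L α)) (C : Sequent L α) : Prop :=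
  ∃ σ, r.concl.inst σ = C ∧ {Q | ∃ M ∈ r.prems, M.inst σ = Q} = P

/-- `𝓛` describes all instances of `r`. -/
structure Rule.LeftFamily (r : Rule L α) (𝓛 : Set (LeftInst L α)) : Prop where
  -- The contexts are arbitrary, so that the rule can be applied again with parts of them replaced
  -- or extended by interpolants.
  hasInst : ∀ ℓ ∈ 𝓛, ∀ X X₀ Δ, r.HasInst (ℓ.prems X X₀ Δ) (ℓ.concl X X₀ Δ)
  exists_inst : ∀ σ, (r.concl.inst σ).Single → ∃ ℓ ∈ 𝓛, ∃ X X₀ Δ,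
    r.concl.inst σ = ℓ.concl X X₀ Δ ∧ ∀ Q ∈ ℓ.prems X X₀ Δ, ∃ M ∈ r.prems, M.inst σ = Q
  free : ∀ p, ∀ ℓ ∈ 𝓛, ℓ.φ.Free p → ℓ.Free p
  finite : ∀ χ, {ℓ ∈ 𝓛 | ℓ.φ = χ}.Finite

/-- `𝓡` describes all instances of `r`. -/
structure Rule.RightFamily (r : Rule L α) (𝓡 : Set (RightInst L α)) : Prop where
  hasInst : ∀ ℓ ∈ 𝓡, ∀ X, r.HasInst (ℓ.prems X) (ℓ.concl X)
  exists_inst : ∀ σ, ∃ ℓ ∈ 𝓡, ∃ X,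
    r.concl.inst σ = ℓ.concl X ∧ ∀ Q ∈ ℓ.prems X, ∃ M ∈ r.prems, M.inst σ = Q
  free : ∀ p, ∀ ℓ ∈ 𝓡, ℓ.φ.Free p → ℓ.Free p
  finite : ∀ χ, {ℓ ∈ 𝓡 | ℓ.φ = χ}.Finite

theorem inst_congr_of_occ {σ τ : MetaSubst L α} {φ χ : MetaForm L α}
    (h : MetaForm.inst σ φ = MetaForm.inst τ φ) (hχ : χ.atoms ⊆ φ.atoms) :
    MetaForm.inst σ χ = MetaForm.inst τ χ :=
  Form.subst_congr fun a ha => Form.eqOn_atoms_of_subst_eq h a (hχ ha)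

theorem free_inst_of_occ {p : α} {σ : MetaSubst L α} {φ χ : MetaForm L α}
    (h : (MetaForm.inst σ φ).Free p) (hχ : χ.atoms ⊆ φ.atoms) : (MetaForm.inst σ χ).Free p := by
  intro hp
  obtain ⟨a, ha, hpa⟩ := Form.mem_atoms_subst.1 hp
  exact h (Form.mem_atoms_subst.2 ⟨a, hχ ha, hpa⟩)

theorem bind_inst_fms (σ : MetaSubst L α) (Φ : Multiset (MetaForm L α)) :
    (fms Φ).bind (MetaItem.inst σ) = Φ.map (MetaForm.inst σ) := by
  simp [fms, Multiset.bind_map, MetaItem.inst, Multiset.bind_singleton]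

theorem bind_inst_ctxs (σ : MetaSubst L α) {n : ℕ} (X : Fin n → ℕ) :
    (ctxs X : Multiset (MetaItem L α)).bind (MetaItem.inst σ) = ∑ i, σ.ctx (X i) := by
  simp only [ctxs, Multiset.bind_map, MetaItem.inst]; rfl

/-- The instance of a pair of multisets of meta-formulas. -/
def instPair (σ : MetaSubst L α) (t : Multiset (MetaForm L α) × Multiset (MetaForm L α)) :
    Sequent L α :=
  ⟨t.1.map (MetaForm.inst σ), t.2.map (MetaForm.inst σ)⟩

theorem instPair_congr {σ τ : MetaSubst L α} {φ : MetaForm L α}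
    {t : Multiset (MetaForm L α) × Multiset (MetaForm L α)}
    (h : MetaForm.inst σ φ = MetaForm.inst τ φ) (h₁ : Occ t.1 φ) (h₂ : Occ t.2 φ) :
    instPair σ t = instPair τ t := by
  unfold instPair
  rw [Multiset.map_congr rfl fun χ hχ => inst_congr_of_occ h (h₁ χ hχ),
    Multiset.map_congr rfl fun χ hχ => inst_congr_of_occ h (h₂ χ hχ)]

theorem free_instPair {p : α} {σ : MetaSubst L α} {φ : MetaForm L α}
    {t : Multiset (MetaForm L α) × Multiset (MetaForm L α)}
    (h : (MetaForm.inst σ φ).Free p) (h₁ : Occ t.1 φ) (h₂ : Occ t.2 φ) :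
    (instPair σ t).Free p := by
  intro χ hχ
  simp only [instPair, Multiset.mem_add, Multiset.mem_map] at hχ
  rcases hχ with ⟨χ, hχ, rfl⟩ | ⟨χ, hχ, rfl⟩
  · exact free_inst_of_occ h (h₁ χ hχ)
  · exact free_inst_of_occ h (h₂ χ hχ)

/-- A common form of left and context-sharing semi-analytic rules. -/
structure LeftData (L : PropLang.{u}) (α : Type v) where
  m : ℕ
  n : ℕ
  pos : 0 < n
  Pi : Fin m → ℕ
  Ga : Fin n → ℕ
  De : Fin n → ℕ
  T : Fin m → Multiset (Multiset (MetaForm L α) × Multiset (MetaForm L α))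
  T' : Fin n → Multiset (Multiset (MetaForm L α) × Multiset (MetaForm L α))
  S : Fin n → Multiset (Multiset (MetaForm L α))
  φ : MetaForm L α
  inj : Function.Injective (Sum.elim Pi (Sum.elim Ga De))
  occ : ∀ j, ∀ t ∈ T j, Occ t.1 φ ∧ Occ t.2 φ
  occ' : ∀ i, ∀ t ∈ T' i, Occ t.1 φ ∧ Occ t.2 φ
  occS : ∀ i, ∀ Φ ∈ S i, Occ Φ φ

namespace LeftData

/-- The rule given by the data. -/
def rule (d : LeftData L α) : Rule L α where
  prems :=
    (∑ j, (d.T j).map fun t => ⟨.ctx (d.Pi j) ::ₘ fms t.1, fms t.2⟩) +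
    (∑ i, (d.T' i).map fun t => ⟨.ctx (d.Ga i) ::ₘ fms t.1, fms t.2⟩) +
    (∑ i, (d.S i).map fun Φ => ⟨.ctx (d.Ga i) ::ₘ fms Φ, {.ctx (d.De i)}⟩)
  concl := ⟨ctxs d.Pi + ctxs d.Ga + {.fm d.φ}, ctxs d.De⟩

/-- The instance with designated context number `i₀`. -/
noncomputable def leftInst (d : LeftData L α) (i₀ : Fin d.n) (σ : MetaSubst L α) :
    LeftInst L α where
  ι := Fin d.m ⊕ {i : Fin d.n // i ≠ i₀}
  -- Away from `i₀` the succedent context is empty, so the premises of `S i` join those with a fixed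
  -- succedent.
  T := Sum.elim (fun j => (d.T j).toList.map (instPair σ)) fun i =>
    (d.T' i).toList.map (instPair σ) ++
      (d.S i).toList.map fun Φ => ⟨Φ.map (MetaForm.inst σ), 0⟩
  T₀ := (d.T' i₀).toList.map (instPair σ)
  S := (d.S i₀).toList.map fun Φ => Φ.map (MetaForm.inst σ)
  φ := MetaForm.inst σ d.φ

theorem leftInst_congr (d : LeftData L α) (i₀ : Fin d.n) {σ τ : MetaSubst L α}
    (h : MetaForm.inst σ d.φ = MetaForm.inst τ d.φ) : d.leftInst i₀ σ = d.leftInst i₀ τ := by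
  have hS : ∀ i, ∀ Φ ∈ d.S i, Φ.map (MetaForm.inst σ) = Φ.map (MetaForm.inst τ) := fun i Φ hΦ =>
    Multiset.map_congr rfl fun χ hχ => inst_congr_of_occ h (d.occS i Φ hΦ χ hχ)
  have hT' : ∀ i, (d.T' i).toList.map (instPair σ) = (d.T' i).toList.map (instPair τ) :=
    fun i => List.map_congr_left fun t ht => by
      have := d.occ' i t (by simpa using ht)
      exact instPair_congr h this.1 this.2
  unfold leftInst
  congr 1
  · funext i
    rcases i with j | i
    · exact List.map_congr_left fun t ht => by
        have := d.occ j t (by simpa using ht)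
        exact instPair_congr h this.1 this.2
    · simp only [Sum.elim_inr, hT']
      congr 1
      exact List.map_congr_left fun Φ hΦ => by rw [hS i Φ (by simpa using hΦ)]
  · exact hT' i₀
  · exact List.map_congr_left fun Φ hΦ => hS i₀ Φ (by simpa using hΦ)

theorem free_leftInst {p : α} (d : LeftData L α) (i₀ : Fin d.n) {σ : MetaSubst L α}
    (h : (MetaForm.inst σ d.φ).Free p) : (d.leftInst i₀ σ).Free p := by
  have hS : ∀ i, ∀ Φ ∈ d.S i, ∀ χ ∈ Φ.map (MetaForm.inst σ), χ.Free p := by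
    intro i Φ hΦ χ hχ
    replace hχ := Multiset.mem_map.1 hχ
    obtain ⟨χ, hχ, rfl⟩ := hχ
    exact free_inst_of_occ h (d.occS i Φ hΦ χ hχ)
  have hT' : ∀ i, ∀ t ∈ (d.T' i).toList.map (instPair σ), t.Free p := by
    intro i t ht
    replace ht := List.mem_map.1 ht
    obtain ⟨t, ht, rfl⟩ := ht
    have := d.occ' i t (by simpa using ht)
    exact free_instPair h this.1 this.2
  refine ⟨?_, hT' i₀, ?_⟩
  · rintro (j | i) t ht
    · replace ht := List.mem_map.1 ht
      obtain ⟨t, ht, rfl⟩ := ht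
      have := d.occ j t (by simpa using ht)
      exact free_instPair h this.1 this.2
    · replace ht := List.mem_append.1 ht
      rcases ht with ht | ht
      · exact hT' i t ht
      · obtain ⟨Φ, hΦ, rfl⟩ := List.mem_map.1 ht
        intro χ hχ
        exact hS i Φ (by simpa using hΦ) χ (by simpa using hχ)
  · intro Φ hΦ
    replace hΦ := List.mem_map.1 hΦ
    obtain ⟨Φ, hΦ, rfl⟩ := hΦ
    exact hS i₀ Φ (by simpa using hΦ)

theorem concl_inst (d : LeftData L α) (i₀ : Fin d.n) (σ : MetaSubst L α)
    (h : ∀ i, i ≠ i₀ → σ.ctx (d.De i) = 0) :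
    d.rule.concl.inst σ = (d.leftInst i₀ σ).concl
      (Sum.elim (fun j => σ.ctx (d.Pi j)) fun i => σ.ctx (d.Ga i)) (σ.ctx (d.Ga i₀))
      (σ.ctx (d.De i₀)) := by
  classical
  have h₁ : ∑ i, σ.ctx (d.De i) = σ.ctx (d.De i₀) :=
    Finset.sum_eq_single i₀ (fun i _ hi => h i hi) (by simp)
  have h₂ : ∑ i : {i : Fin d.n // i ≠ i₀}, σ.ctx (d.Ga i) + σ.ctx (d.Ga i₀) =
      ∑ i, σ.ctx (d.Ga i) := by
    rw [add_comm, ← Fintype.sum_eq_add_sum_subtype_ne (fun i => σ.ctx (d.Ga i)) i₀]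
  ext1
  · simp only [MetaSequent.inst, rule, Multiset.add_bind, bind_inst_ctxs, Multiset.singleton_bind,
      LeftInst.concl, MetaItem.inst, leftInst, ← h₂, add_assoc]
    erw [Fintype.sum_sum_type]
    simp [add_assoc]
  · simp only [MetaSequent.inst, rule, bind_inst_ctxs, LeftInst.concl, h₁]

theorem prems_inst (d : LeftData L α) (i₀ : Fin d.n) (σ : MetaSubst L α)
    (h : ∀ i, i ≠ i₀ → σ.ctx (d.De i) = 0) :
    {Q | ∃ M ∈ d.rule.prems, M.inst σ = Q} = (d.leftInst i₀ σ).prems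
      (Sum.elim (fun j => σ.ctx (d.Pi j)) fun i => σ.ctx (d.Ga i)) (σ.ctx (d.Ga i₀))
      (σ.ctx (d.De i₀)) := by
  have hT : ∀ X (t : Multiset (MetaForm L α) × Multiset (MetaForm L α)),
      MetaSequent.inst σ ⟨.ctx X ::ₘ fms t.1, fms t.2⟩ =
        ⟨σ.ctx X + (instPair σ t).ant, (instPair σ t).suc⟩ := by
    intro X t
    simp [MetaSequent.inst, bind_inst_fms, instPair, MetaItem.inst]
  have hS : ∀ X Y (Φ : Multiset (MetaForm L α)),
      MetaSequent.inst σ ⟨.ctx X ::ₘ fms Φ, {.ctx Y}⟩ =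
        ⟨σ.ctx X + Φ.map (MetaForm.inst σ), σ.ctx Y⟩ := by
    intro X Y Φ
    simp [MetaSequent.inst, bind_inst_fms, MetaItem.inst]
  ext Q
  simp only [rule, Multiset.mem_add, Multiset.mem_sum, Finset.mem_univ, true_and,
    Multiset.mem_map, LeftInst.prems, Set.mem_ofPred_eq]
  constructor
  · rintro ⟨M, (⟨j, t, ht, rfl⟩ | ⟨i, t, ht, rfl⟩) | ⟨i, Φ, hΦ, rfl⟩, rfl⟩
    · exact .inl ⟨.inl j, _, List.mem_map_of_mem (Multiset.mem_toList.2 ht), hT _ _⟩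
    · by_cases hi : i = i₀
      · subst hi
        exact .inr (.inl ⟨_, List.mem_map_of_mem (Multiset.mem_toList.2 ht), hT _ _⟩)
      · exact .inl ⟨.inr ⟨i, hi⟩, _, List.mem_append_left _
          (List.mem_map_of_mem (Multiset.mem_toList.2 ht)), hT _ _⟩
    · by_cases hi : i = i₀
      · subst hi
        exact .inr (.inr ⟨_, List.mem_map_of_mem (Multiset.mem_toList.2 hΦ), hS _ _ _⟩)
      · refine .inl ⟨.inr ⟨i, hi⟩, _, List.mem_append_right _
          (List.mem_map_of_mem (Multiset.mem_toList.2 hΦ)), ?_⟩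
        rw [hS, h i hi]; rfl
  · rintro (⟨j | i, t, ht, rfl⟩ | ⟨t, ht, rfl⟩ | ⟨Φ, hΦ, rfl⟩)
    · replace ht := List.mem_map.1 ht
      obtain ⟨t, ht, rfl⟩ := ht
      exact ⟨_, .inl (.inl ⟨j, t, Multiset.mem_toList.1 ht, rfl⟩), hT _ _⟩
    · replace ht := List.mem_append.1 ht
      rcases ht with ht | ht
      · replace ht := List.mem_map.1 ht
        obtain ⟨t, ht, rfl⟩ := ht
        exact ⟨_, .inl (.inr ⟨i, t, Multiset.mem_toList.1 ht, rfl⟩), hT _ _⟩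
      · obtain ⟨Φ, hΦ, rfl⟩ := List.mem_map.1 ht
        refine ⟨_, .inr ⟨i, Φ, Multiset.mem_toList.1 hΦ, rfl⟩, ?_⟩
        rw [hS, h i i.2]; rfl
    · replace ht := List.mem_map.1 ht
      obtain ⟨t, ht, rfl⟩ := ht
      exact ⟨_, .inl (.inr ⟨i₀, t, Multiset.mem_toList.1 ht, rfl⟩), hT _ _⟩
    · replace hΦ := List.mem_map.1 hΦ
      obtain ⟨Φ, hΦ, rfl⟩ := hΦ
      exact ⟨_, .inr ⟨i₀, Φ, Multiset.mem_toList.1 hΦ, rfl⟩, hS _ _ _⟩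

/-- Pairwise distinct contexts can be given any values independently. In a single-conclusion
instance at most one succedent context is non-empty, and it becomes the designated one; if all are
empty, any index will do, and `0 < n` provides one. Once the principal formula is given, only the
choice of this index is left, whence finiteness. -/
theorem leftFamily (d : LeftData L α) :
    d.rule.LeftFamily {ℓ | ∃ i₀ σ, ℓ = d.leftInst i₀ σ} where
  hasInst := by
    classical
    rintro _ ⟨i₀, τ, rfl⟩ X X₀ Δ
    let e := Sum.elim d.Pi (Sum.elim d.Ga d.De)
    let v : Fin d.m ⊕ (Fin d.n ⊕ Fin d.n) → Multiset (Form L α) :=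
      Sum.elim (fun j => X (.inl j)) (Sum.elim
        (fun i => if h : i = i₀ then X₀ else X (.inr ⟨i, h⟩)) fun i => if i = i₀ then Δ else 0)
    let σ : MetaSubst L α := ⟨τ.form, Function.extend e v 0⟩
    have hv : ∀ a, σ.ctx (e a) = v a := fun a => d.inj.extend_apply v 0 a
    have hDe : ∀ i, i ≠ i₀ → σ.ctx (d.De i) = 0 := fun i hi =>
      (hv (.inr (.inr i))).trans (if_neg hi)
    have hσ : d.leftInst i₀ τ = d.leftInst i₀ σ := d.leftInst_congr i₀ rfl
    have hX : X = (Sum.elim (fun j => σ.ctx (d.Pi j)) fun i => σ.ctx (d.Ga i) :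
        Fin d.m ⊕ {i : Fin d.n // i ≠ i₀} → Multiset (Form L α)) := by
      funext i
      rcases i with j | i
      · exact (hv (.inl j)).symm
      · exact ((hv (.inr (.inl i))).trans (dif_neg i.2)).symm
    have hX₀ : X₀ = σ.ctx (d.Ga i₀) := ((hv (.inr (.inl i₀))).trans (dif_pos rfl)).symm
    have hΔ : Δ = σ.ctx (d.De i₀) := ((hv (.inr (.inr i₀))).trans (if_pos rfl)).symm
    refine ⟨σ, ?_, ?_⟩
    · rw [d.concl_inst i₀ σ hDe, ← hX, ← hX₀, ← hΔ]; rfl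
    · rw [d.prems_inst i₀ σ hDe, ← hX, ← hX₀, ← hΔ]; rfl
  exists_inst := by
    intro σ hσ
    have hcard : Multiset.card (∑ i, σ.ctx (d.De i)) ≤ 1 := by
      simpa [Sequent.Single, MetaSequent.inst, rule, bind_inst_ctxs] using hσ
    obtain ⟨i₀, hi₀⟩ : ∃ i₀, ∀ i, i ≠ i₀ → σ.ctx (d.De i) = 0 := by
      by_cases h0 : ∀ i, σ.ctx (d.De i) = 0
      · exact ⟨⟨0, d.pos⟩, fun i _ => h0 i⟩
      · push Not at h0
        obtain ⟨i₀, hi₀⟩ := h0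
        refine ⟨i₀, fun i hi => ?_⟩
        by_contra hne
        have h₁ := Multiset.card_pos.2 hi₀
        have h₂ := Multiset.card_pos.2 hne
        have h₃ : ∑ j ∈ {i, i₀}, Multiset.card (σ.ctx (d.De j)) ≤
            ∑ j, Multiset.card (σ.ctx (d.De j)) :=
          Finset.sum_le_sum_of_subset (Finset.subset_univ _)
        rw [Finset.sum_pair hi, ← Multiset.card_sum] at h₃
        omega
    refine ⟨_, ⟨i₀, σ, rfl⟩, _, _, _, d.concl_inst i₀ σ hi₀, ?_⟩
    rw [← d.prems_inst i₀ σ hi₀]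
    exact fun Q hQ => hQ
  free := by
    rintro p _ ⟨i₀, σ, rfl⟩ h
    exact d.free_leftInst i₀ h
  finite := by
    intro χ
    have : {ℓ | (∃ i₀ σ, ℓ = d.leftInst i₀ σ) ∧ ℓ.φ = χ} ⊆
        ⋃ i₀, {ℓ | ∃ σ, MetaForm.inst σ d.φ = χ ∧ ℓ = d.leftInst i₀ σ} := by
      rintro _ ⟨⟨i₀, σ, rfl⟩, h⟩
      exact Set.mem_iUnion.2 ⟨i₀, σ, h, rfl⟩
    refine (Set.finite_iUnion fun i₀ => Set.Subsingleton.finite ?_).subset this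
    rintro _ ⟨σ, hσ, rfl⟩ _ ⟨τ, hτ, rfl⟩
    exact d.leftInst_congr i₀ (hσ.trans hτ.symm)

end LeftData

theorem Rule.IsLeftSemiAnalytic.exists_family {r : Rule L α} (h : r.IsLeftSemiAnalytic) :
    ∃ 𝓛, r.LeftFamily 𝓛 := by
  obtain ⟨m, n, Pi, Ga, De, T, S, φ, hn, hinj, hT, hS, hp, hc⟩ := h
  let d : LeftData L α := ⟨m, n, hn, Pi, Ga, De, T, 0, S, φ, hinj, hT, by simp, hS⟩
  have : r = d.rule := by
    cases r
    simp only [LeftData.rule, d, Rule.mk.injEq]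
    exact ⟨by simpa using hp, hc⟩
  exact this ▸ ⟨_, d.leftFamily⟩

theorem Rule.IsContextSharingSemiAnalytic.exists_family {r : Rule L α}
    (h : r.IsContextSharingSemiAnalytic) : ∃ 𝓛, r.LeftFamily 𝓛 := by
  obtain ⟨n, Ga, De, T, S, φ, hn, hinj, hT, hS, hp, hc⟩ := h
  let d : LeftData L α := ⟨0, n, hn, Fin.elim0, Ga, De, Fin.elim0, T, S, φ,
    Function.Injective.sumElim (fun i => i.elim0) hinj fun i => i.elim0,
    fun i => i.elim0, hT, hS⟩
  have : r = d.rule := by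
    cases r
    simp only [LeftData.rule, d, Rule.mk.injEq]
    exact ⟨by simpa using hp, by simpa [ctxs] using hc⟩
  exact this ▸ ⟨_, d.leftFamily⟩

theorem Rule.IsRightSemiAnalytic.exists_family {r : Rule L α}
    (h : r.IsRightSemiAnalytic) : ∃ 𝓡, r.RightFamily 𝓡 := by
  obtain ⟨n, Ga, T, φ, hinj, hocc, hp, hc⟩ := h
  let R : MetaSubst L α → RightInst L α := fun σ =>
    { ι := Fin n, T := fun i => (T i).toList.map (instPair σ), φ := MetaForm.inst σ φ }
  have hR : ∀ σ τ, MetaForm.inst σ φ = MetaForm.inst τ φ → R σ = R τ := by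
    intro σ τ h
    simp only [R]
    congr 1
    funext i
    exact List.map_congr_left fun t ht => by
      have := hocc i t (by simpa using ht)
      exact instPair_congr h this.1 this.2
  have hconcl : ∀ σ, r.concl.inst σ = (R σ).concl fun i => σ.ctx (Ga i) := by
    intro σ
    rw [hc]
    simp [MetaSequent.inst, bind_inst_ctxs, RightInst.concl, R, MetaItem.inst]
  have hprems : ∀ σ, {Q | ∃ M ∈ r.prems, M.inst σ = Q} =
      (R σ).prems fun i => σ.ctx (Ga i) := by
    intro σ
    have hT : ∀ X (t : Multiset (MetaForm L α) × Multiset (MetaForm L α)),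
        MetaSequent.inst σ ⟨.ctx X ::ₘ fms t.1, fms t.2⟩ =
          ⟨σ.ctx X + (instPair σ t).ant, (instPair σ t).suc⟩ := by
      intro X t
      simp [MetaSequent.inst, bind_inst_fms, instPair, MetaItem.inst]
    ext Q
    rw [hp]
    simp only [Multiset.mem_sum, Finset.mem_univ, true_and,
      Multiset.mem_map, RightInst.prems, Set.mem_ofPred_eq]
    constructor
    · rintro ⟨M, ⟨i, t, ht, rfl⟩, rfl⟩
      exact ⟨i, _, List.mem_map_of_mem (Multiset.mem_toList.2 ht), hT _ _⟩
    · rintro ⟨i, t, ht, rfl⟩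
      replace ht := List.mem_map.1 ht
      obtain ⟨t, ht, rfl⟩ := ht
      exact ⟨_, ⟨i, t, Multiset.mem_toList.1 ht, rfl⟩, hT _ _⟩
  refine ⟨Set.range R, ?_, ?_, ?_, ?_⟩
  · rintro _ ⟨τ, rfl⟩ X
    let σ : MetaSubst L α := ⟨τ.form, Function.extend Ga X 0⟩
    have hX : X = fun i => σ.ctx (Ga i) := funext fun i => (hinj.extend_apply X 0 i).symm
    have hσ : R τ = R σ := hR _ _ rfl
    exact ⟨σ, by rw [hconcl, ← hX]; rfl, by rw [hprems, ← hX]; rfl⟩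
  · intro σ
    refine ⟨_, ⟨σ, rfl⟩, _, hconcl σ, ?_⟩
    rw [← hprems]
    exact fun Q hQ => hQ
  · rintro p _ ⟨σ, rfl⟩ h i t ht
    replace ht := List.mem_map.1 ht
    obtain ⟨t, ht, rfl⟩ := ht
    have := hocc i t (by simpa using ht)
    exact free_instPair h this.1 this.2
  · intro χ
    apply Set.Subsingleton.finite
    rintro _ ⟨⟨σ, rfl⟩, hσ⟩ _ ⟨⟨τ, rfl⟩, hτ⟩
    exact hR _ _ (hσ.trans hτ.symm)

/-! ### Instances of modal rules and of axioms -/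

theorem Rule.IsK.hasInst {r : Rule L α} (h : r.IsK) {b : L.Conn 1} (hb : b ∈ L.box)
    (A : Multiset (Form L α)) (φ : Form L α) :
    r.HasInst {⟨A, {φ}⟩} ⟨A.map (Form.app1 b), {Form.app1 b φ}⟩ := by
  obtain ⟨b', hb', X, k, rfl⟩ := h
  obtain rfl := Option.mem_unique hb hb'
  refine ⟨⟨fun _ => φ, fun _ => A⟩, ?_, ?_⟩
  · simp [MetaSequent.inst, MetaItem.inst]
  · ext Q
    simp [MetaSequent.inst, MetaItem.inst, eq_comm]

theorem Rule.IsK.exists_inst {r : Rule L α} (h : r.IsK) (σ : MetaSubst L α) :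
    ∃ b ∈ L.box, ∃ A φ, r.concl.inst σ = ⟨A.map (Form.app1 b), {Form.app1 b φ}⟩ ∧
      ∃ M ∈ r.prems, M.inst σ = ⟨A, {φ}⟩ := by
  obtain ⟨b, hb, X, k, rfl⟩ := h
  refine ⟨b, hb, σ.ctx X, σ.form k, ?_, _, Multiset.mem_singleton_self _, ?_⟩ <;>
    simp [MetaSequent.inst, MetaItem.inst]

theorem Rule.IsD.hasInst {r : Rule L α} (h : r.IsD) {b : L.Conn 1} (hb : b ∈ L.box)
    {A : Multiset (Form L α)} (hA : A ≠ 0) :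
    r.HasInst {⟨A, 0⟩} ⟨A.map (Form.app1 b), 0⟩ := by
  obtain ⟨b', hb', X, k, rfl⟩ := h
  obtain rfl := Option.mem_unique hb hb'
  obtain ⟨φ, hφ⟩ := Multiset.exists_mem_of_ne_zero hA
  obtain ⟨B, rfl⟩ := Multiset.exists_cons_of_mem hφ
  have hB : B + {φ} = φ ::ₘ B := by rw [add_comm, Multiset.singleton_add]
  refine ⟨⟨fun _ => φ, fun _ => B⟩, ?_, ?_⟩
  · simp [MetaSequent.inst, MetaItem.inst, ← hB]
  · ext Q
    simp [MetaSequent.inst, MetaItem.inst, ← hB, eq_comm]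

theorem Rule.IsD.exists_inst {r : Rule L α} (h : r.IsD) (σ : MetaSubst L α) :
    ∃ b ∈ L.box, ∃ A : Multiset (Form L α), A ≠ 0 ∧
      r.concl.inst σ = ⟨A.map (Form.app1 b), 0⟩ ∧ ∃ M ∈ r.prems, M.inst σ = ⟨A, 0⟩ := by
  obtain ⟨b, hb, X, k, rfl⟩ := h
  refine ⟨b, hb, σ.ctx X + {σ.form k}, by simp, ?_, _, Multiset.mem_singleton_self _, ?_⟩ <;>
    simp [MetaSequent.inst, MetaItem.inst]

theorem Rule.inst_ofSequent (S : Sequent L α) (σ : MetaSubst L α) :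
    (Rule.ofSequent S).concl.inst σ = S := by
  have h : ∀ A : Multiset (Form L α), (A.map fun φ =>
      (MetaItem.fm (φ.subst fun a => .atom (.inl a)) : MetaItem L α)).bind (MetaItem.inst σ) =
        A := by
    intro A
    simp only [Multiset.bind_map, MetaItem.inst, MetaForm.inst]
    rw [Multiset.bind_singleton]
    simp [Form.subst_atom_subst (Sum.elim Form.atom σ.form) Sum.inl (fun _ => rfl)]
  ext1
  · exact h S.ant
  · exact h S.suc

/-! ### The families of instances of a rule -/

/-- The instances of a rule, if it is a left or context-sharing semi-analytic rule. -/
noncomputable def Rule.leftFam (r : Rule L α) : Set (LeftInst L α) :=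
  open scoped Classical in if h : ∃ 𝓛, r.LeftFamily 𝓛 then h.choose else ∅

/-- The instances of a rule, if it is a right semi-analytic rule. -/
noncomputable def Rule.rightFam (r : Rule L α) : Set (RightInst L α) :=
  open scoped Classical in if h : ∃ 𝓡, r.RightFamily 𝓡 then h.choose else ∅

theorem Rule.leftFamily_leftFam {r : Rule L α} (h : ∃ 𝓛, r.LeftFamily 𝓛) :
    r.LeftFamily r.leftFam := by
  rw [leftFam, dif_pos h]; exact h.choose_spec

theorem Rule.rightFamily_rightFam {r : Rule L α} (h : ∃ 𝓡, r.RightFamily 𝓡) :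
    r.RightFamily r.rightFam := by
  rw [rightFam, dif_pos h]; exact h.choose_spec

theorem Rule.leftFamily_of_mem {r : Rule L α} {ℓ : LeftInst L α} (h : ℓ ∈ r.leftFam) :
    r.LeftFamily r.leftFam := by
  by_cases h' : ∃ 𝓛, r.LeftFamily 𝓛
  · exact r.leftFamily_leftFam h'
  · simp [leftFam, h'] at h

theorem Rule.rightFamily_of_mem {r : Rule L α} {ℓ : RightInst L α} (h : ℓ ∈ r.rightFam) :
    r.RightFamily r.rightFam := by
  by_cases h' : ∃ 𝓡, r.RightFamily 𝓡
  · exact r.rightFamily_rightFam h'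
  · simp [rightFam, h'] at h

/-- The premises with fixed succedent are single-conclusion. -/
def LeftInst.Ok (ℓ : LeftInst L α) : Prop :=
  (∀ i, ∀ t ∈ ℓ.T i, t.Single) ∧ ∀ t ∈ ℓ.T₀, t.Single

/-- The premises are single-conclusion. -/
def RightInst.Ok (ℓ : RightInst L α) : Prop := ∀ i, ∀ t ∈ ℓ.T i, t.Single

theorem LeftInst.Ok.single {ℓ : LeftInst L α} (h : ℓ.Ok) {X : ℓ.ι → Multiset (Form L α)}
    {X₀ Δ : Multiset (Form L α)} (hΔ : Multiset.card Δ ≤ 1) :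
    ∀ Q ∈ ℓ.prems X X₀ Δ, Q.Single := by
  rintro Q (⟨i, t, ht, rfl⟩ | ⟨t, ht, rfl⟩ | ⟨Φ, hΦ, rfl⟩)
  exacts [h.1 i t ht, h.2 t ht, hΔ]

theorem RightInst.Ok.single {ℓ : RightInst L α} (h : ℓ.Ok) {X : ℓ.ι → Multiset (Form L α)} :
    ∀ Q ∈ ℓ.prems X, Q.Single := by
  rintro Q ⟨i, t, ht, rfl⟩
  exact h i t ht

theorem Rule.HasInst.exists_valid {r : Rule L α} {P : Set (Sequent L α)} {C : Sequent L α}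
    (h : r.HasInst P C) (hC : C.Single) (hP : ∀ Q ∈ P, Q.Single) :
    ∃ σ, r.Valid σ ∧ r.concl.inst σ = C ∧ {Q | ∃ M ∈ r.prems, M.inst σ = Q} = P := by
  obtain ⟨σ, h₁, h₂⟩ := h
  exact ⟨σ, ⟨h₁ ▸ hC, fun M hM => hP _ (h₂ ▸ ⟨M, hM, rfl⟩)⟩, h₁, h₂⟩

theorem Rule.HasInst.backwardApplicable {r : Rule L α} {P : Set (Sequent L α)} {C : Sequent L α}
    (h : r.HasInst P C) (hC : C.Single) (hP : ∀ Q ∈ P, Q.Single) : r.BackwardApplicable C := by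
  obtain ⟨σ, hσ, h₁, -⟩ := h.exists_valid hC hP
  exact ⟨σ, hσ, h₁⟩

theorem Rule.HasInst.derivable {r : Rule L α} {P : Set (Sequent L α)} {C : Sequent L α}
    (h : r.HasInst P C) {H : Calculus L α} (hr : r ∈ H) (hC : C.Single)
    (hP : ∀ Q ∈ P, H.Derivable Q) : H.Derivable C := by
  obtain ⟨σ, hσ, h₁, h₂⟩ := h.exists_valid hC fun Q hQ => (hP Q hQ).single
  rw [← h₁]
  exact .step r hr σ hσ fun M hM => hP _ (h₂ ▸ ⟨M, hM, rfl⟩)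

/-! ### The interpolants -/

/-- The conjunction of the first components of the values of `f` at the premises `X, Φ ⇒ Θ`. -/
def blockForm (f : Sequent L α → Form L α × Form L α) (X : Multiset (Form L α))
    (T : List (Sequent L α)) : Form L α :=
  bigAnd (T.map fun t => (f ⟨X + t.ant, t.suc⟩).1)

/-- The disjuncts of the right interpolant of `S`, where `f` gives the interpolants of smaller
sequents and `c` is the disjunct provided by the axioms. -/
inductive RightDisjunct (R : Calculus L α) (c : Form L α)
    (f : Sequent L α → Form L α × Form L α) (S : Sequent L α) : Form L α → Prop
  | ax : RightDisjunct R c f S c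
  -- Serves left rules with `p`-free principal formula: there, a premise carrying the succedent of
  -- the conclusion sees only a part of the antecedent of `S`.
  | sub (A : Multiset (Form L α)) (hA : A < S.ant) : RightDisjunct R c f S (f ⟨A, S.suc⟩).1
  -- Premises of one block share their context, hence the conjunction inside a block; contexts of
  -- different blocks are added up, hence the fusion of blocks.
  | left (r : Rule L α) (hr : r ∈ R) (ℓ : LeftInst L α) (hℓ : ℓ ∈ r.leftFam) (hok : ℓ.Ok)
      (X : ℓ.ι → Multiset (Form L α)) (X₀ : Multiset (Form L α))
      (h : ℓ.concl X X₀ S.suc = S) : RightDisjunct R c f S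
        (.app2 L.fus (famFus fun i => blockForm f (X i) (ℓ.T i))
          (blockForm f X₀ (ℓ.T₀ ++ ℓ.S.map fun Φ => ⟨Φ, S.suc⟩)))
  | right (r : Rule L α) (hr : r ∈ R) (ℓ : RightInst L α) (hℓ : ℓ ∈ r.rightFam) (hok : ℓ.Ok)
      (X : ℓ.ι → Multiset (Form L α)) (h : ℓ.concl X = S) :
      RightDisjunct R c f S (famFus fun i => blockForm f (X i) (ℓ.T i))
  | boxK (r : Rule L α) (hr : r ∈ R) (hK : r.IsK) (b : L.Conn 1) (hb : b ∈ L.box)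
      (A : Multiset (Form L α)) (φ : Form L α)
      (h : S = ⟨A.map (Form.app1 b), {Form.app1 b φ}⟩) :
      RightDisjunct R c f S (.app1 b (f ⟨A, {φ}⟩).1)
  -- Soundness of this disjunct uses (D), but it is reached from the `p`-free side by (K).
  | boxD (r : Rule L α) (hr : r ∈ R) (hD : r.IsD) (b : L.Conn 1) (hb : b ∈ L.box)
      (A : Multiset (Form L α)) (hA : A ≠ 0)
      (h : S = ⟨A.map (Form.app1 b), 0⟩) :
      RightDisjunct R c f S (.app1 b (f ⟨A, 0⟩).1)

/-- The conjuncts of the left interpolant of `M ⇒`, where `f` gives the interpolants of smaller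
sequents and `c` is the conjunct provided by the axioms. -/
inductive LeftConjunct (R : Calculus L α) (c : Form L α)
    (f : Sequent L α → Form L α × Form L α) (M : Multiset (Form L α)) : Form L α → Prop
  | ax : LeftConjunct R c f M c
  -- Merges left interpolants of parts of the antecedent. Both parts are non-empty, so that each is
  -- a proper subsequent.
  | split (A B : Multiset (Form L α)) (hA : A ≠ 0) (hB : B ≠ 0) (h : A + B = M) :
      LeftConjunct R c f M (.app2 L.fus (f ⟨A, 0⟩).2 (f ⟨B, 0⟩).2)
  -- The premises in `ℓ.S` prove different left interpolants, but the rule needs one common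
  -- succedent: the disjunction. The inner implication reflects that `ℓ.T₀` and `ℓ.S` share the
  -- context `X₀`.
  | left (r : Rule L α) (hr : r ∈ R) (ℓ : LeftInst L α) (hℓ : ℓ ∈ r.leftFam) (hok : ℓ.Ok)
      (X : ℓ.ι → Multiset (Form L α)) (X₀ : Multiset (Form L α))
      (h : ℓ.concl X X₀ 0 = ⟨M, 0⟩) : LeftConjunct R c f M
        (.app2 L.imp (famFus fun i => blockForm f (X i) (ℓ.T i))
          (.app2 L.imp (blockForm f X₀ ℓ.T₀) (bigOr (ℓ.S.map fun Φ => (f ⟨X₀ + Φ, 0⟩).2))))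
  -- This conjunct serves (D) too, since (K) is present whenever (D) is.
  | box (r : Rule L α) (hr : r ∈ R) (hK : r.IsK) (b : L.Conn 1) (hb : b ∈ L.box)
      (A : Multiset (Form L α)) (hA : A ≠ 0) (h : A.map (Form.app1 b) = M) :
      LeftConjunct R c f M (.app1 b (f ⟨A, 0⟩).2)

/-! ### Freeness and finiteness of the disjuncts and conjuncts -/

theorem free_blockForm {p : α} {f : Sequent L α → Form L α × Form L α}
    (hf : ∀ S, (f S).1.Free p ∧ (f S).2.Free p) (X : Multiset (Form L α))
    (T : List (Sequent L α)) : (blockForm f X T).Free p :=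
  free_bigAnd fun φ hφ => by
    obtain ⟨t, -, rfl⟩ := List.mem_map.1 hφ
    exact (hf _).1

theorem RightDisjunct.free {p : α} {R : Calculus L α} {c : Form L α}
    {f : Sequent L α → Form L α × Form L α} {S : Sequent L α} {ψ : Form L α}
    (h : RightDisjunct R c f S ψ) (hc : c.Free p) (hf : ∀ S, (f S).1.Free p ∧ (f S).2.Free p) :
    ψ.Free p := by
  cases h with
  | ax => exact hc
  | sub A hA => exact (hf _).1
  | left => exact Form.free_app2.2 ⟨free_famFus fun i => free_blockForm hf _ _,
      free_blockForm hf _ _⟩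
  | right => exact free_famFus fun i => free_blockForm hf _ _
  | boxK => exact Form.free_app1.2 (hf _).1
  | boxD => exact Form.free_app1.2 (hf _).1

theorem LeftConjunct.free {p : α} {R : Calculus L α} {c : Form L α}
    {f : Sequent L α → Form L α × Form L α} {M : Multiset (Form L α)} {ψ : Form L α}
    (h : LeftConjunct R c f M ψ) (hc : c.Free p) (hf : ∀ S, (f S).1.Free p ∧ (f S).2.Free p) :
    ψ.Free p := by
  cases h with
  | ax => exact hc
  | split => exact Form.free_app2.2 ⟨(hf _).2, (hf _).2⟩
  | left =>
    refine Form.free_app2.2 ⟨free_famFus fun i => free_blockForm hf _ _,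
      Form.free_app2.2 ⟨free_blockForm hf _ _, free_bigOr fun φ hφ => ?_⟩⟩
    obtain ⟨t, -, rfl⟩ := List.mem_map.1 hφ
    exact (hf _).2
  | box => exact Form.free_app1.2 (hf _).2

/-- Every choice is finite: a backward applicable rule, a principal formula among the members of the
antecedent, an instance with that principal formula, and contexts contained in the antecedent. -/
theorem finite_leftInst {R : Calculus L α} {S : Sequent L α} (hS : S.Single)
    (hR : {r ∈ R | r.BackwardApplicable S}.Finite)
    (g : (ℓ : LeftInst L α) → (ℓ.ι → Multiset (Form L α)) → Multiset (Form L α) → Form L α) :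
    {ψ | ∃ r ∈ R, ∃ ℓ ∈ r.leftFam, ℓ.Ok ∧ ∃ X X₀, ℓ.concl X X₀ S.suc = S ∧
      ψ = g ℓ X X₀}.Finite := by
  classical
  refine Set.Finite.subset (s := ⋃ r ∈ {r ∈ R | r.BackwardApplicable S}, ⋃ χ ∈ {χ | χ ∈ S.ant},
    ⋃ ℓ ∈ {ℓ ∈ r.leftFam | ℓ.φ = χ}, (fun Y => g ℓ Y.1 Y.2) ''
      ({X | ∀ i, X i ≤ S.ant} ×ˢ Set.Iic S.ant)) ?_ ?_
  · refine hR.biUnion fun r hr => Set.Finite.biUnion ?_ fun χ hχ => Set.Finite.biUnion ?_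
      fun ℓ hℓ => Set.Finite.image _ (Set.Finite.prod ?_ (Set.finite_Iic _))
    · exact S.ant.toFinset.finite_toSet.subset fun χ hχ => by simpa using hχ
    · by_cases h : ∃ ℓ, ℓ ∈ r.leftFam
      · obtain ⟨ℓ, hℓ⟩ := h
        exact (r.leftFamily_of_mem hℓ).finite χ
      · push Not at h
        exact Set.finite_empty.subset fun ℓ hℓ => h ℓ hℓ.1
    · exact finite_of_forall_le S.ant _ fun X hX => hX
  · rintro _ ⟨r, hr, ℓ, hℓ, hok, X, X₀, h, rfl⟩
    have hinst := (r.leftFamily_of_mem hℓ).hasInst ℓ hℓ X X₀ S.suc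
    rw [h] at hinst
    have hant : ∑ i, X i + X₀ + {ℓ.φ} = S.ant := congrArg Sequent.ant h
    simp only [Set.mem_iUnion]
    refine ⟨r, ⟨hr, hinst.backwardApplicable hS (hok.single hS)⟩, ℓ.φ, ?_, ℓ, ⟨hℓ, rfl⟩,
      (X, X₀), ⟨fun i => ?_, ?_⟩, rfl⟩
    · simp [← hant]
    · rw [← hant, add_assoc]
      exact (Finset.single_le_sum (fun _ _ => zero_le) (Finset.mem_univ i)).trans
        (Multiset.le_add_right _ _)
    · change X₀ ≤ S.ant
      rw [← hant, add_right_comm]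
      exact Multiset.le_add_left _ _

theorem finite_rightInst {R : Calculus L α} {S : Sequent L α} (hS : S.Single)
    (hR : {r ∈ R | r.BackwardApplicable S}.Finite)
    (g : (ℓ : RightInst L α) → (ℓ.ι → Multiset (Form L α)) → Form L α) :
    {ψ | ∃ r ∈ R, ∃ ℓ ∈ r.rightFam, ℓ.Ok ∧ ∃ X, ℓ.concl X = S ∧ ψ = g ℓ X}.Finite := by
  classical
  refine Set.Finite.subset (s := ⋃ r ∈ {r ∈ R | r.BackwardApplicable S}, ⋃ χ ∈ {χ | χ ∈ S.suc},
    ⋃ ℓ ∈ {ℓ ∈ r.rightFam | ℓ.φ = χ}, (fun X => g ℓ X) '' {X | ∀ i, X i ≤ S.ant}) ?_ ?_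
  · refine hR.biUnion fun r hr => Set.Finite.biUnion ?_ fun χ hχ => Set.Finite.biUnion ?_
      fun ℓ hℓ => Set.Finite.image _ ?_
    · exact S.suc.toFinset.finite_toSet.subset fun χ hχ => by simpa using hχ
    · by_cases h : ∃ ℓ, ℓ ∈ r.rightFam
      · obtain ⟨ℓ, hℓ⟩ := h
        exact (r.rightFamily_of_mem hℓ).finite χ
      · push Not at h
        exact Set.finite_empty.subset fun ℓ hℓ => h ℓ hℓ.1
    · exact finite_of_forall_le S.ant _ fun X hX => hX
  · rintro _ ⟨r, hr, ℓ, hℓ, hok, X, h, rfl⟩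
    have hinst := (r.rightFamily_of_mem hℓ).hasInst ℓ hℓ X
    rw [h] at hinst
    simp only [Set.mem_iUnion]
    refine ⟨r, ⟨hr, hinst.backwardApplicable hS hok.single⟩, ℓ.φ, ?_, ℓ, ⟨hℓ, rfl⟩,
      X, fun i => ?_, rfl⟩
    · simp [← h, RightInst.concl]
    · simp only [← h, RightInst.concl]
      exact Finset.single_le_sum (fun _ _ => zero_le) (Finset.mem_univ i)

theorem RightDisjunct.finite {R : Calculus L α} {c : Form L α}
    {f : Sequent L α → Form L α × Form L α} {S : Sequent L α} (hS : S.Single)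
    (hR : {r ∈ R | r.BackwardApplicable S}.Finite) : {ψ | RightDisjunct R c f S ψ}.Finite := by
  classical
  refine ((((((Set.finite_singleton c).union
    ((Set.finite_Iio S.ant).image fun A => (f ⟨A, S.suc⟩).1)).union
    (finite_leftInst hS hR fun ℓ X X₀ =>
      .app2 L.fus (famFus fun i => blockForm f (X i) (ℓ.T i))
          (blockForm f X₀ (ℓ.T₀ ++ ℓ.S.map fun Φ => ⟨Φ, S.suc⟩)))).union
    (finite_rightInst hS hR fun ℓ X => famFus fun i => blockForm f (X i) (ℓ.T i))).union
    (Set.Subsingleton.finite (s := {ψ | ∃ b ∈ L.box, ∃ A φ,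
      S = ⟨A.map (Form.app1 b), {Form.app1 b φ}⟩ ∧ ψ = .app1 b (f ⟨A, {φ}⟩).1}) ?_)).union
    (Set.Subsingleton.finite (s := {ψ | ∃ b ∈ L.box, ∃ A,
      S = ⟨A.map (Form.app1 b), 0⟩ ∧ ψ = .app1 b (f ⟨A, 0⟩).1}) ?_)).subset ?_
  -- There is at most one modal disjunct of each kind, because prefixing the modality is injective,
  -- also on multisets.
  · rintro _ ⟨b, hb, A, φ, h, rfl⟩ _ ⟨b', hb', A', φ', h', rfl⟩
    obtain rfl := Option.mem_unique hb hb'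
    have := h.symm.trans h'
    simp only [Sequent.mk.injEq, Multiset.singleton_inj] at this
    rw [Multiset.map_injective (Form.app1_injective b) this.1, Form.app1_injective b this.2]
  · rintro _ ⟨b, hb, A, h, rfl⟩ _ ⟨b', hb', A', h', rfl⟩
    obtain rfl := Option.mem_unique hb hb'
    have := h.symm.trans h'
    simp only [Sequent.mk.injEq] at this
    rw [Multiset.map_injective (Form.app1_injective b) this.1]
  · intro ψ hψ
    cases hψ with
    | ax => exact .inl (.inl (.inl (.inl (.inl rfl))))
    | sub A hA => exact .inl (.inl (.inl (.inl (.inr ⟨A, hA, rfl⟩))))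
    | left r hr ℓ hℓ hok X X₀ h =>
      exact .inl (.inl (.inl (.inr ⟨r, hr, ℓ, hℓ, hok, X, X₀, h, rfl⟩)))
    | right r hr ℓ hℓ hok X h => exact .inl (.inl (.inr ⟨r, hr, ℓ, hℓ, hok, X, h, rfl⟩))
    | boxK r hr hK b hb A φ h => exact .inl (.inr ⟨b, hb, A, φ, h, rfl⟩)
    | boxD r hr hD b hb A hA h => exact .inr ⟨b, hb, A, h, rfl⟩

theorem LeftConjunct.finite {R : Calculus L α} {c : Form L α}
    {f : Sequent L α → Form L α × Form L α} {M : Multiset (Form L α)}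
    (hR : {r ∈ R | r.BackwardApplicable ⟨M, 0⟩}.Finite) : {ψ | LeftConjunct R c f M ψ}.Finite := by
  classical
  have hS : Sequent.Single (⟨M, 0⟩ : Sequent L α) := by simp [Sequent.Single]
  refine ((((Set.finite_singleton c).union
    (((Set.finite_Iic M).prod (Set.finite_Iic M)).image fun A =>
      .app2 L.fus (f ⟨A.1, 0⟩).2 (f ⟨A.2, 0⟩).2)).union
    (finite_leftInst hS hR fun ℓ X X₀ =>
      .app2 L.imp (famFus fun i => blockForm f (X i) (ℓ.T i))
        (.app2 L.imp (blockForm f X₀ ℓ.T₀) (bigOr (ℓ.S.map fun Φ => (f ⟨X₀ + Φ, 0⟩).2))))).union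
    (Set.Subsingleton.finite (s := {ψ | ∃ b ∈ L.box, ∃ A,
      A.map (Form.app1 b) = M ∧ ψ = .app1 b (f ⟨A, 0⟩).2}) ?_)).subset ?_
  · rintro _ ⟨b, hb, A, h, rfl⟩ _ ⟨b', hb', A', h', rfl⟩
    obtain rfl := Option.mem_unique hb hb'
    rw [Multiset.map_injective (Form.app1_injective b) (h.trans h'.symm)]
  · intro ψ hψ
    cases hψ with
    | ax => exact .inl (.inl (.inl rfl))
    | split A B hA hB h =>
      exact .inl (.inl (.inr ⟨(A, B), ⟨h ▸ Multiset.le_add_right A B,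
        h ▸ Multiset.le_add_left B A⟩, rfl⟩))
    | left r hr ℓ hℓ hok X X₀ h =>
      exact .inl (.inr ⟨r, hr, ℓ, hℓ, hok, X, X₀, h, rfl⟩)
    | box r hr hK b hb A hA h => exact .inr ⟨b, hb, A, h, rfl⟩

theorem exists_map_split {γ δ : Type*} {g : γ → δ} {C : Multiset γ} {A B : Multiset δ}
    (h : C.map g = A + B) : ∃ A' B', C = A' + B' ∧ A = A'.map g ∧ B = B'.map g := by
  induction C using Multiset.induction_on generalizing A B with
  | empty =>
    obtain ⟨rfl, rfl⟩ := add_eq_zero.1 (h.symm.trans (Multiset.map_zero g))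
    exact ⟨0, 0, by simp⟩
  | cons a C ih =>
    rw [Multiset.map_cons, ← Multiset.singleton_add] at h
    obtain ⟨C₁, C₂, D₁, D₂, hC, hD, rfl, rfl⟩ := exists_split_add h
    obtain ⟨A', B', rfl, rfl, rfl⟩ := ih hD
    rcases singleton_eq_add hC with ⟨rfl, rfl⟩ | ⟨rfl, rfl⟩
    · exact ⟨{a} + A', B', by simp, by simp, by simp⟩
    · exact ⟨A', {a} + B', by simp, by simp, by simp⟩

/-! ### The recursion defining the interpolants -/

/-- The values of `F` below `S`, extended by a constant. -/
noncomputable def below (lt : Sequent L α → Sequent L α → Prop)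
    (F : Sequent L α → Form L α × Form L α) (S T : Sequent L α) : Form L α × Form L α :=
  open scoped Classical in
  -- The default only has to be `p`-free; the values that enter the disjuncts and conjuncts are all
  -- taken at smaller single-conclusion sequents.
  if lt T S ∧ T.Single then F T else (.app0 L.top, .app0 L.top)

/-- The left interpolant of `S̃`, from the values `f` of the interpolants of smaller sequents. -/
noncomputable def leftStep (R : Calculus L α) (J : Sequent L α → Form L α)
    (f : Sequent L α → Form L α × Form L α) (S : Sequent L α) : Form L α :=
  open scoped Classical in
  -- The order is not assumed transitive, so sequents below `S̃` need not be below `S`; the value at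
  -- `S̃` itself is used instead.
  if S.suc = 0 then setAnd {ψ | LeftConjunct R (J S) f S.ant ψ} else (f S.tilde).2

/-- The disjunction entering the right interpolant of `S`, from the values `f` of the
interpolants of smaller sequents. -/
noncomputable def rightStep (R : Calculus L α) (I J : Sequent L α → Form L α)
    (f : Sequent L α → Form L α × Form L α) (S : Sequent L α) : Form L α :=
  setOr {ψ | RightDisjunct R (.app2 L.imp (J S.tilde) (I S)) f S ψ}

/-- `F` assigns to `S` its right interpolant and the left interpolant of `S̃`. -/
def IsInterpolant (R : Calculus L α) (lt : Sequent L α → Sequent L α → Prop)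
    (I J : Sequent L α → Form L α) (F : Sequent L α → Form L α × Form L α) : Prop :=
  ∀ S, F S = (.app2 L.imp (leftStep R J (below lt F S) S) (rightStep R I J (below lt F S) S),
    leftStep R J (below lt F S) S)

theorem exists_isInterpolant (R : Calculus L α) {lt : Sequent L α → Sequent L α → Prop}
    (hlt : WellFounded lt) (I J : Sequent L α → Form L α) : ∃ F, IsInterpolant R lt I J F := by
  classical
  let step (f : Sequent L α → Form L α × Form L α) (S : Sequent L α) : Form L α × Form L α :=
    (.app2 L.imp (leftStep R J f S) (rightStep R I J f S), leftStep R J f S)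
  let F := hlt.fix (C := fun _ => Form L α × Form L α) fun S rec => step (fun T =>
    if h : lt T S ∧ T.Single then rec T h.1 else (.app0 L.top, .app0 L.top)) S
  refine ⟨F, fun S => ?_⟩
  have h : (fun T => if _h : lt T S ∧ T.Single then F T else (.app0 L.top, .app0 L.top)) =
      below lt F S := by
    funext T
    simp only [below, dite_eq_ite]
  change F S = step (below lt F S) S
  rw [← h]
  exact hlt.fix_eq _ S

/-- The data from which the interpolants of `H` for the atom `p` are built: interpolants `I`, `J`
for `G`, the order `lt` on sequents, and the resulting assignment `F`. -/
structure InterpolationData (G H R : Calculus L α) (p : α)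
    (lt : Sequent L α → Sequent L α → Prop) (I J : Sequent L α → Form L α)
    (F : Sequent L α → Form L α × Form L α) : Prop where
  int : H.IsIntuitionistic
  ext : H.IsAxiomaticExtension G R
  semi : R.ConsistsOfSemiAnalyticRules
  fin : ∀ S : Sequent L α, S.Single → {r ∈ H | r.BackwardApplicable S}.Finite
  wf : WellFounded lt
  lt_prem : ∀ r ∈ H, ∀ σ, r.Valid σ → ∀ P ∈ r.prems, lt (P.inst σ) (r.concl.inst σ)
  lt_sub : ∀ S T : Sequent L α, S.Single → T.Sub S → T ≠ S → lt T S
  lt_box : ∀ b ∈ L.box, ∀ Γ P Δ Λ : Multiset (Form L α), P + Λ ≠ 0 →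
    Sequent.Single ⟨Γ + P.map (Form.app1 b), Δ + Λ.map (Form.app1 b)⟩ →
    lt ⟨Γ + P, Δ + Λ⟩ ⟨Γ + P.map (Form.app1 b), Δ + Λ.map (Form.app1 b)⟩
  right : ∀ S : Sequent L α, S.Single →
    (I S).Free p ∧ H.Derivable (S * ⟨{I S}, 0⟩) ∧
    ∀ Γ : Multiset (Form L α), (∀ χ ∈ Γ, χ.Free p) →
      G.Derivable (S * ⟨Γ, 0⟩) → H.Derivable ⟨J S.tilde ::ₘ Γ, {I S}⟩
  left : ∀ T : Sequent L α, T.suc = 0 →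
    (J T).Free p ∧ H.Derivable (T * ⟨0, {J T}⟩) ∧
    ∀ Γ Δ : Multiset (Form L α), (∀ χ ∈ Γ, χ.Free p) → (∀ χ ∈ Δ, χ.Free p) →
      G.Derivable (T * ⟨Γ, Δ⟩) → H.Derivable ⟨J T ::ₘ Γ, Δ⟩
  interp : IsInterpolant R lt I J F

namespace InterpolationData

variable {G H R : Calculus L α} {p : α} {lt : Sequent L α → Sequent L α → Prop}
  {I J : Sequent L α → Form L α} {F : Sequent L α → Form L α × Form L α}
  (D : InterpolationData G H R p lt I J F) {S T : Sequent L α}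
  {Γ Δ M A B X : Multiset (Form L α)} {φ ψ : Form L α}

include D

theorem mem {r : Rule L α} (hr : r ∈ R) : r ∈ H := by
  rw [D.ext]; exact .inr hr

theorem finite (hS : S.Single) : {r ∈ R | r.BackwardApplicable S}.Finite :=
  (D.fin S hS).subset fun _ h => ⟨D.mem h.1, h.2⟩

theorem lt_of_hasInst {r : Rule L α} (hr : r ∈ R) {P : Set (Sequent L α)} {C : Sequent L α}
    (h : r.HasInst P C) (hC : C.Single) (hP : ∀ Q ∈ P, Q.Single) : ∀ Q ∈ P, lt Q C := by
  obtain ⟨σ, hσ, rfl, rfl⟩ := h.exists_valid hC hP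
  rintro _ ⟨M, hM, rfl⟩
  exact D.lt_prem r (D.mem hr) σ hσ M hM

omit D in
theorem left_hasInst {r : Rule L α} {ℓ : LeftInst L α} (hℓ : ℓ ∈ r.leftFam)
    (X : ℓ.ι → Multiset (Form L α)) (X₀ Δ : Multiset (Form L α)) :
    r.HasInst (ℓ.prems X X₀ Δ) (ℓ.concl X X₀ Δ) :=
  (r.leftFamily_of_mem hℓ).hasInst ℓ hℓ X X₀ Δ

theorem left_derivable {r : Rule L α} (hr : r ∈ R) {ℓ : LeftInst L α} (hℓ : ℓ ∈ r.leftFam)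
    (X : ℓ.ι → Multiset (Form L α)) (X₀ : Multiset (Form L α)) (hΔ : Multiset.card Δ ≤ 1)
    (hT : ∀ i, ∀ t ∈ ℓ.T i, H.Derivable ⟨X i + t.ant, t.suc⟩)
    (hT₀ : ∀ t ∈ ℓ.T₀, H.Derivable ⟨X₀ + t.ant, t.suc⟩)
    (hS : ∀ Φ ∈ ℓ.S, H.Derivable ⟨X₀ + Φ, Δ⟩) :
    H.Derivable ⟨∑ i, X i + X₀ + {ℓ.φ}, Δ⟩ := by
  refine (left_hasInst hℓ X X₀ Δ).derivable (D.mem hr) hΔ ?_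
  rintro _ (⟨i, t, ht, rfl⟩ | ⟨t, ht, rfl⟩ | ⟨Φ, hΦ, rfl⟩)
  exacts [hT i t ht, hT₀ t ht, hS Φ hΦ]

theorem right_derivable {r : Rule L α} (hr : r ∈ R) {ℓ : RightInst L α} (hℓ : ℓ ∈ r.rightFam)
    (X : ℓ.ι → Multiset (Form L α))
    (hT : ∀ i, ∀ t ∈ ℓ.T i, H.Derivable ⟨X i + t.ant, t.suc⟩) :
    H.Derivable ⟨∑ i, X i, {ℓ.φ}⟩ := by
  refine ((r.rightFamily_of_mem hℓ).hasInst ℓ hℓ X).derivable (D.mem hr) ?_ ?_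
  · simp [Sequent.Single, RightInst.concl]
  rintro _ ⟨i, t, ht, rfl⟩
  exact hT i t ht

theorem boxK_derivable {r : Rule L α} (hr : r ∈ R) (hK : r.IsK) {b : L.Conn 1} (hb : b ∈ L.box)
    (h : H.Derivable ⟨A, {φ}⟩) : H.Derivable ⟨A.map (Form.app1 b), {Form.app1 b φ}⟩ :=
  (hK.hasInst hb A φ).derivable (D.mem hr) (by simp [Sequent.Single]) (by simpa using h)

theorem boxD_derivable {r : Rule L α} (hr : r ∈ R) (hD : r.IsD) {b : L.Conn 1} (hb : b ∈ L.box)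
    (hA : A ≠ 0) (h : H.Derivable ⟨A, 0⟩) : H.Derivable ⟨A.map (Form.app1 b), 0⟩ :=
  (hD.hasInst hb hA).derivable (D.mem hr) (by simp [Sequent.Single]) (by simpa using h)

theorem lt_box_ant {b : L.Conn 1} (hb : b ∈ L.box) (hA : A ≠ 0) :
    lt ⟨A, 0⟩ ⟨A.map (Form.app1 b), 0⟩ := by
  simpa using D.lt_box b hb 0 A 0 0 (by simpa using hA) (by simp [Sequent.Single])

theorem lt_boxK {r : Rule L α} (hr : r ∈ R) (hK : r.IsK) {b : L.Conn 1} (hb : b ∈ L.box) :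
    lt ⟨A, {φ}⟩ ⟨A.map (Form.app1 b), {Form.app1 b φ}⟩ :=
  D.lt_of_hasInst hr (hK.hasInst hb A φ) (by simp [Sequent.Single]) (by simp [Sequent.Single]) _ rfl

omit D in
theorem below_eq (h : lt T S) (hT : T.Single) : below lt F S T = F T :=
  if_pos ⟨h, hT⟩

theorem fst_eq (S : Sequent L α) :
    (F S).1 = .app2 L.imp (F S).2 (rightStep R I J (below lt F S) S) := by
  rw [D.interp S]

theorem snd_eq (S : Sequent L α) : (F S).2 = leftStep R J (below lt F S) S := by
  rw [D.interp S]

theorem snd_of_suc (h : S.suc = 0) :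
    (F S).2 = setAnd {ψ | LeftConjunct R (J S) (below lt F S) S.ant ψ} := by
  rw [D.snd_eq, leftStep, if_pos h]

omit D in
theorem single_of_suc (h : S.suc = 0) : S.Single := by simp [Sequent.Single, h]

theorem snd_tilde (hS : S.Single) : (F S).2 = (F S.tilde).2 := by
  by_cases h : S.suc = 0
  · congr 2; ext1
    · rfl
    · exact h
  · rw [D.snd_eq, leftStep, if_neg h, below_eq]
    · exact D.lt_sub S _ hS ⟨le_rfl, Multiset.zero_le _⟩ fun e => h (by rw [← e]; rfl)
    · exact single_of_suc rfl

omit D in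
theorem free_below (h : ∀ T, lt T S → T.Single → (F T).1.Free p ∧ (F T).2.Free p)
    (T : Sequent L α) : (below lt F S T).1.Free p ∧ (below lt F S T).2.Free p := by
  unfold below
  split_ifs with hT
  · exact h T hT.1 hT.2
  · simp

theorem free (S : Sequent L α) (hS : S.Single) : (F S).1.Free p ∧ (F S).2.Free p := by
  induction S using D.wf.induction with
  | _ S ih =>
    have hb := free_below ih
    have h₂ : (F S).2.Free p := by
      rw [D.snd_eq, leftStep]
      split_ifs with h
      · exact free_setAnd fun ψ hψ => LeftConjunct.free hψ (D.left S h).1 hb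
      · exact (hb _).2
    refine ⟨?_, h₂⟩
    rw [D.fst_eq]
    refine Form.free_app2.2 ⟨h₂, free_setOr fun ψ hψ => RightDisjunct.free hψ ?_ hb⟩
    exact Form.free_app2.2 ⟨(D.left _ rfl).1, (D.right S hS).1⟩

/-! ### The interpolants are sound -/

/-- Exchanging the interpolant of a premise for that of its block gives all premises of the block
the same enlarged context, as the rule requires. -/
theorem block_left {f : Sequent L α → Form L α × Form L α} {l : List (Sequent L α)}
    {t : Sequent L α} (ht : t ∈ l)
    (h : H.Derivable ⟨X + t.ant + {(f ⟨X + t.ant, t.suc⟩).1}, Δ⟩) :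
    H.Derivable ⟨X + {blockForm f X l} + t.ant, Δ⟩ := by
  rw [add_right_comm]
  exact D.int.bigAndL (List.mem_map.2 ⟨t, ht, rfl⟩) h

theorem sound_conjunct {S : Sequent L α} (hS : S.suc = 0)
    (ih : ∀ T, lt T S → T.Single → H.Derivable ⟨T.ant + {(F T).1}, T.suc⟩ ∧
      H.Derivable ⟨T.ant, {(F T).2}⟩)
    (hψ : LeftConjunct R (J S) (below lt F S) S.ant ψ) : H.Derivable ⟨S.ant, {ψ}⟩ := by
  have hSeq : (⟨S.ant, 0⟩ : Sequent L α) = S := by ext1; exacts [rfl, hS.symm]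
  have hsingle : S.Single := single_of_suc hS
  cases hψ with
  | ax =>
    have := (D.left S hS).2.1
    rw [← hSeq] at this
    simpa [HMul.hMul, Mul.mul, hSeq] using this
  | split A B hA hB h =>
    have hlA : lt ⟨A, 0⟩ S := D.lt_sub S _ hsingle
      ⟨h ▸ Multiset.le_add_right A B, Multiset.zero_le _⟩ fun e => hB (by
        rw [← e] at h; simpa using h)
    have hlB : lt ⟨B, 0⟩ S := D.lt_sub S _ hsingle
      ⟨h ▸ Multiset.le_add_left B A, Multiset.zero_le _⟩ fun e => hA (by
        rw [← e] at h; simpa using h)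
    rw [below_eq hlA (single_of_suc rfl), below_eq hlB (single_of_suc rfl), ← h]
    exact D.int.fusR (ih _ hlA (single_of_suc rfl)).2 (ih _ hlB (single_of_suc rfl)).2
  | box r hr hK b hb A hA h =>
    have hl : lt ⟨A, 0⟩ S := by
      rw [← hSeq, ← h]; exact D.lt_box_ant hb hA
    rw [below_eq hl (single_of_suc rfl), ← h]
    exact D.boxK_derivable hr hK hb (ih _ hl (single_of_suc rfl)).2
  | left r hr ℓ hℓ hok X X₀ h =>
    rw [hSeq] at h
    have hlt : ∀ Q ∈ ℓ.prems X X₀ 0, lt Q S := by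
      have := left_hasInst hℓ X X₀ 0
      rw [h] at this
      exact D.lt_of_hasInst hr this hsingle (hok.single (by simp))
    have hih : ∀ Q ∈ ℓ.prems X X₀ 0, H.Derivable ⟨Q.ant + {(below lt F S Q).1}, Q.suc⟩ ∧
        H.Derivable ⟨Q.ant, {(below lt F S Q).2}⟩ := by
      intro Q hQ
      have hQs := hok.single (by simp) Q hQ
      rw [below_eq (hlt Q hQ) hQs]
      exact ih Q (hlt Q hQ) hQs
    have hant : S.ant = ∑ i, X i + X₀ + {ℓ.φ} := congrArg Sequent.ant h.symm
    generalize below lt F S = f at hih ⊢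
    apply D.int.impR
    apply D.int.impR
    rw [add_right_comm]
    apply D.int.famFusL
    -- The rule itself, with every context enlarged by the interpolant of its block and with the
    -- disjunction as its succedent context.
    have := D.left_derivable hr hℓ (fun i => X i + {blockForm f (X i) (ℓ.T i)})
      (X₀ + {blockForm f X₀ ℓ.T₀})
      (Δ := {bigOr (ℓ.S.map fun Φ => (f ⟨X₀ + Φ, 0⟩).2)}) (by simp)
      (fun i t ht => D.block_left ht (hih _ (.inl ⟨i, t, ht, rfl⟩)).1)
      (fun t ht => D.block_left ht (hih _ (.inr (.inl ⟨t, ht, rfl⟩))).1)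
      (fun Φ hΦ => by
        rw [add_right_comm]
        exact D.int.weakL_one (D.int.bigOrR (List.mem_map.2 ⟨Φ, hΦ, rfl⟩)
          (hih _ (.inr (.inr ⟨Φ, hΦ, rfl⟩))).2))
    rw [Finset.sum_add_distrib] at this
    convert this using 2
    rw [hant]
    abel

theorem sound_disjunct {S : Sequent L α} (hS : S.Single)
    (ih : ∀ T, lt T S → T.Single → H.Derivable ⟨T.ant + {(F T).1}, T.suc⟩ ∧
      H.Derivable ⟨T.ant, {(F T).2}⟩)
    (hψ : RightDisjunct R (.app2 L.imp (J S.tilde) (I S)) (below lt F S) S ψ) :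
    H.Derivable ⟨S.ant + {ψ}, S.suc⟩ := by
  cases hψ with
  | ax =>
    have h₁ := (D.left S.tilde rfl).2.1
    have h₂ := (D.right S hS).2.1
    refine D.int.impCS ?_ ?_
    · simpa [HMul.hMul, Mul.mul, Sequent.tilde] using h₁
    · simpa [HMul.hMul, Mul.mul] using h₂
  | sub A hA =>
    have hl : lt ⟨A, S.suc⟩ S := D.lt_sub S _ hS ⟨hA.le, le_rfl⟩ fun e =>
      hA.ne (congrArg Sequent.ant e)
    rw [below_eq hl hS]
    refine D.int.weakL_of_le ?_ (ih _ hl hS).1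
    exact add_le_add_left hA.le _
  | left r hr ℓ hℓ hok X X₀ h =>
    have hlt : ∀ Q ∈ ℓ.prems X X₀ S.suc, lt Q S := by
      have := left_hasInst hℓ X X₀ S.suc
      rw [h] at this
      exact D.lt_of_hasInst hr this hS (hok.single hS)
    have hih : ∀ Q ∈ ℓ.prems X X₀ S.suc,
        H.Derivable ⟨Q.ant + {(below lt F S Q).1}, Q.suc⟩ := by
      intro Q hQ
      have hQs := hok.single hS Q hQ
      rw [below_eq (hlt Q hQ) hQs]
      exact (ih Q (hlt Q hQ) hQs).1
    have hant : S.ant = ∑ i, X i + X₀ + {ℓ.φ} := congrArg Sequent.ant h.symm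
    generalize below lt F S = f at hih ⊢
    apply D.int.fusL
    rw [Multiset.insert_eq_cons, ← Multiset.singleton_add, add_comm {famFus _}, ← add_assoc]
    apply D.int.famFusL
    -- Here the succedent context stays as it is, and the premises from `ℓ.S` also use the
    -- interpolant of their block.
    have := D.left_derivable hr hℓ (fun i => X i + {blockForm f (X i) (ℓ.T i)})
      (X₀ + {blockForm f X₀ (ℓ.T₀ ++ ℓ.S.map fun Φ => ⟨Φ, S.suc⟩)}) (Δ := S.suc) hS
      (fun i t ht => D.block_left ht (hih _ (.inl ⟨i, t, ht, rfl⟩)))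
      (fun t ht => D.block_left (List.mem_append_left _ ht) (hih _ (.inr (.inl ⟨t, ht, rfl⟩))))
      (fun Φ hΦ => D.block_left (t := ⟨Φ, S.suc⟩)
        (List.mem_append_right _ (List.mem_map.2 ⟨Φ, hΦ, rfl⟩))
        (hih _ (.inr (.inr ⟨Φ, hΦ, rfl⟩))))
    rw [Finset.sum_add_distrib] at this
    convert this using 2
    rw [hant]
    abel
  | right r hr ℓ hℓ hok X h =>
    have hih : ∀ Q ∈ ℓ.prems X, H.Derivable ⟨Q.ant + {(below lt F S Q).1}, Q.suc⟩ := by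
      intro Q hQ
      have hQs := hok.single Q hQ
      have := (r.rightFamily_of_mem hℓ).hasInst ℓ hℓ X
      rw [h] at this
      have hl := D.lt_of_hasInst hr this hS hok.single Q hQ
      rw [below_eq hl hQs]
      exact (ih Q hl hQs).1
    generalize below lt F S = f at hih ⊢
    apply D.int.famFusL
    have := D.right_derivable hr hℓ (fun i => X i + {blockForm f (X i) (ℓ.T i)})
      (fun i t ht => D.block_left ht (hih _ ⟨i, t, ht, rfl⟩))
    rw [Finset.sum_add_distrib] at this
    rw [← h]
    exact this
  | boxK r hr hK b hb A φ h =>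
    subst h
    have hs : Sequent.Single (⟨A, {φ}⟩ : Sequent L α) := by simp [Sequent.Single]
    rw [below_eq (D.lt_boxK hr hK hb) hs]
    simpa using D.boxK_derivable hr hK hb (ih _ (D.lt_boxK hr hK hb) hs).1
  | boxD r hr hD b hb A hA h =>
    subst h
    rw [below_eq (D.lt_box_ant hb hA) (single_of_suc rfl)]
    simpa using D.boxD_derivable hr hD hb (by simp)
      (ih _ (D.lt_box_ant hb hA) (single_of_suc rfl)).1

/-- Both claims need a joint induction: conjuncts from left rules contain right interpolants of
premises, and the right interpolant of `S` is an implication whose antecedent is a left interpolant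
that `S.ant` has to prove. -/
theorem sound (S : Sequent L α) (hS : S.Single) :
    H.Derivable ⟨S.ant + {(F S).1}, S.suc⟩ ∧ H.Derivable ⟨S.ant, {(F S).2}⟩ := by
  induction S using D.wf.induction with
  | _ S ih =>
    have h₂ : H.Derivable ⟨S.ant, {(F S).2}⟩ := by
      by_cases h : S.suc = 0
      · rw [D.snd_of_suc h]
        exact D.int.setAndR fun ψ hψ => D.sound_conjunct h ih hψ
      · rw [D.snd_tilde hS]
        exact (ih S.tilde (D.lt_sub S _ hS ⟨le_rfl, Multiset.zero_le _⟩ fun e => h (by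
          rw [← e]; rfl)) (single_of_suc rfl)).2
    refine ⟨?_, h₂⟩
    rw [D.fst_eq]
    exact D.int.impCS h₂ (D.int.setOrL hS fun ψ hψ => D.sound_disjunct hS ih hψ)

end InterpolationData

/-- The left interpolant of `M ⇒`, which is left out if `M` is empty. -/
noncomputable def leftCtx (F : Sequent L α → Form L α × Form L α) (M : Multiset (Form L α)) :
    Multiset (Form L α) :=
  open scoped Classical in if M = 0 then 0 else {(F ⟨M, 0⟩).2}

-- The omission matters. The empty antecedent has no proper splitting and no box conjunct, and there
-- is no cut by which its derivable left interpolant could be removed afterwards.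
@[simp] theorem leftCtx_zero (F : Sequent L α → Form L α × Form L α) : leftCtx F 0 = 0 :=
  if_pos rfl

theorem leftCtx_of_ne {F : Sequent L α → Form L α × Form L α} {M : Multiset (Form L α)}
    (h : M ≠ 0) : leftCtx F M = {(F ⟨M, 0⟩).2} :=
  if_neg h

theorem leftCtx_le (F : Sequent L α → Form L α × Form L α) (M : Multiset (Form L α)) :
    leftCtx F M ≤ {(F ⟨M, 0⟩).2} := by
  unfold leftCtx
  split_ifs
  exacts [Multiset.zero_le _, le_rfl]

namespace InterpolationData

variable {G H R : Calculus L α} {p : α} {lt : Sequent L α → Sequent L α → Prop}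
  {I J : Sequent L α → Form L α} {F : Sequent L α → Form L α × Form L α}
  (D : InterpolationData G H R p lt I J F) {S T Q : Sequent L α}
  {Γ Δ M A B X : Multiset (Form L α)} {φ ψ : Form L α}

include D

/-! ### The interpolants are complete -/

theorem disjunct_right (hS : S.Single)
    (hψ : RightDisjunct R (.app2 L.imp (J S.tilde) (I S)) (below lt F S) S ψ)
    (h : H.Derivable ⟨Γ, {ψ}⟩) : H.Derivable ⟨Γ, {rightStep R I J (below lt F S) S}⟩ :=
  D.int.setOrR (RightDisjunct.finite hS (D.finite hS)) hψ h

/-- The outer implication absorbs the left interpolant, leaving only `p`-free side formulas in the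
antecedent. This is the form to which (K) and the right rule for fusion can be applied. -/
theorem fst_right (hS : S.Single)
    (h : H.Derivable ⟨leftCtx F S.ant + Γ, {rightStep R I J (below lt F S) S}⟩) :
    H.Derivable ⟨Γ, {(F S).1}⟩ := by
  rw [D.fst_eq, D.snd_tilde hS]
  refine D.int.impR (D.int.weakL_of_le ?_ h)
  rw [add_comm]
  exact add_le_add_right (leftCtx_le F _) _

theorem conjunct_left (hM : M ≠ 0)
    (hψ : LeftConjunct R (J ⟨M, 0⟩) (below lt F ⟨M, 0⟩) M ψ)
    (h : H.Derivable ⟨Γ + {ψ}, Δ⟩) : H.Derivable ⟨leftCtx F M + Γ, Δ⟩ := by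
  rw [leftCtx_of_ne hM, D.snd_of_suc rfl, add_comm]
  exact D.int.setAndL (LeftConjunct.finite (D.finite (single_of_suc rfl))) hψ h

/-- Two non-empty parts are merged by the `split` conjunct; an empty part contributes nothing. -/
theorem leftCtx_add (h : H.Derivable ⟨leftCtx F A + leftCtx F B + Γ, Δ⟩) :
    H.Derivable ⟨leftCtx F (A + B) + Γ, Δ⟩ := by
  by_cases hA : A = 0
  · simpa [hA] using h
  by_cases hB : B = 0
  · simpa [hB] using h
  have hlA : lt ⟨A, 0⟩ ⟨A + B, 0⟩ := D.lt_sub _ _ (single_of_suc rfl)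
    ⟨Multiset.le_add_right A B, Multiset.zero_le _⟩ fun e => hB (by
      simpa using congrArg Sequent.ant e)
  have hlB : lt ⟨B, 0⟩ ⟨A + B, 0⟩ := D.lt_sub _ _ (single_of_suc rfl)
    ⟨Multiset.le_add_left B A, Multiset.zero_le _⟩ fun e => hA (by
      simpa using congrArg Sequent.ant e)
  refine D.conjunct_left (by simp [hA]) (.split A B hA hB rfl) (D.int.fusL ?_)
  rw [below_eq hlA (single_of_suc rfl), below_eq hlB (single_of_suc rfl)]
  rw [leftCtx_of_ne hA, leftCtx_of_ne hB, add_comm, Multiset.singleton_add] at h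
  exact h

theorem leftCtx_sum {ι : Type*} (s : Finset ι) (X : ι → Multiset (Form L α))
    (h : H.Derivable ⟨∑ i ∈ s, leftCtx F (X i) + Γ, Δ⟩) :
    H.Derivable ⟨leftCtx F (∑ i ∈ s, X i) + Γ, Δ⟩ := by
  classical
  induction s using Finset.induction_on generalizing Γ with
  | empty => simpa using h
  | insert i s hi ih =>
    rw [Finset.sum_insert hi] at h ⊢
    apply D.leftCtx_add
    rw [add_comm (leftCtx F (X i)), add_assoc]
    apply ih
    rwa [← add_assoc, add_comm (∑ i ∈ s, leftCtx F (X i))]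

omit D in
/-- The two completeness properties of the interpolants at the sequent `Q`. -/
def Interpolates (H R : Calculus L α) (p : α) (lt : Sequent L α → Sequent L α → Prop)
    (I J : Sequent L α → Form L α) (F : Sequent L α → Form L α × Form L α) (Q : Sequent L α) :
    Prop :=
  (∀ (S : Sequent L α) (Γ : Multiset (Form L α)), (∀ χ ∈ Γ, χ.Free p) → Q = ⟨S.ant + Γ, S.suc⟩ →
    H.Derivable ⟨leftCtx F S.ant + Γ, {rightStep R I J (below lt F S) S}⟩) ∧
  ∀ M Γ Δ : Multiset (Form L α), (∀ χ ∈ Γ, χ.Free p) → (∀ χ ∈ Δ, χ.Free p) → Q = ⟨M + Γ, Δ⟩ →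
    H.Derivable ⟨leftCtx F M + Γ, Δ⟩

theorem fst_of_interpolates (hS : S.Single) (hΓ : ∀ χ ∈ Γ, χ.Free p)
    (h : Interpolates H R p lt I J F ⟨S.ant + Γ, S.suc⟩) : H.Derivable ⟨Γ, {(F S).1}⟩ :=
  D.fst_right hS (h.1 S Γ hΓ rfl)

theorem interpolates_ax (hG : G.Derivable Q) (hQ : H.Derivable Q) :
    Interpolates H R p lt I J F Q := by
  refine ⟨?_, ?_⟩
  · rintro S Γ hΓ rfl
    have hS : S.Single := hG.single
    -- The interpolation of `G` is only weak and leaves `J S.tilde` beside `Γ`; the disjunct for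
    -- axioms is an implication in order to absorb it.
    refine D.disjunct_right hS .ax (D.int.impR ?_)
    have := (D.right S hS).2.2 Γ hΓ (by simpa [HMul.hMul, Mul.mul] using hG)
    rw [← Multiset.singleton_add, add_comm] at this
    refine D.int.weakL_of_le ?_ this
    exact add_le_add_left (Multiset.le_add_left _ _) _
  · rintro M Γ Δ hΓ hΔ rfl
    by_cases hM : M = 0
    · simpa [hM] using hQ
    refine D.conjunct_left hM .ax ?_
    have := (D.left ⟨M, 0⟩ rfl).2.2 Γ Δ hΓ hΔ (by simpa [HMul.hMul, Mul.mul] using hG)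
    rwa [← Multiset.singleton_add, add_comm] at this

theorem interpolates_boxK {r : Rule L α} (hr : r ∈ R) (hK : r.IsK) {b : L.Conn 1}
    (hb : b ∈ L.box) (h : Interpolates H R p lt I J F ⟨A, {φ}⟩) :
    Interpolates H R p lt I J F ⟨A.map (Form.app1 b), {Form.app1 b φ}⟩ := by
  refine ⟨?_, ?_⟩
  · rintro ⟨M, Δ⟩ Γ hΓ hQ
    simp only [Sequent.mk.injEq] at hQ
    obtain ⟨hA, rfl⟩ := hQ
    obtain ⟨A, B, rfl, rfl, rfl⟩ := exists_map_split hA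
    have hs : Sequent.Single (⟨A, {φ}⟩ : Sequent L α) := by simp [Sequent.Single]
    have hB : ∀ χ ∈ B, χ.Free p := fun χ hχ =>
      Form.free_app1.1 (hΓ _ (Multiset.mem_map_of_mem _ hχ))
    have h₁ := D.boxK_derivable hr hK hb (D.fst_of_interpolates hs hB h)
    rw [← below_eq (F := F) (D.lt_boxK hr hK hb) hs] at h₁
    refine D.disjunct_right (by simp [Sequent.Single]) (.boxK r hr hK b hb A φ rfl) ?_
    rw [add_comm]
    exact D.int.weakL _ h₁
  · rintro M Γ Δ hΓ hΔ hQ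
    simp only [Sequent.mk.injEq] at hQ
    obtain ⟨hA, rfl⟩ := hQ
    obtain ⟨A, B, rfl, rfl, rfl⟩ := exists_map_split hA
    have hφ : φ.Free p := Form.free_app1.1 (hΔ _ (Multiset.mem_singleton_self _))
    have hB : ∀ χ ∈ B, χ.Free p := fun χ hχ =>
      Form.free_app1.1 (hΓ _ (Multiset.mem_map_of_mem _ hχ))
    have h₁ := D.boxK_derivable hr hK hb (h.2 A B {φ} hB (by simpa using hφ) rfl)
    by_cases hA0 : A = 0
    · simpa [hA0] using h₁
    refine D.conjunct_left (by simpa using hA0) (.box r hr hK b hb A hA0 rfl) ?_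
    rw [below_eq (D.lt_box_ant hb hA0) (single_of_suc rfl)]
    rw [leftCtx_of_ne hA0, add_comm] at h₁
    simpa using h₁

theorem interpolates_boxD {r : Rule L α} (hr : r ∈ R) (hD : r.IsD) {b : L.Conn 1}
    (hb : b ∈ L.box) (hA : A ≠ 0) (hQ : H.Derivable ⟨A.map (Form.app1 b), 0⟩)
    (h : Interpolates H R p lt I J F ⟨A, 0⟩) :
    Interpolates H R p lt I J F ⟨A.map (Form.app1 b), 0⟩ := by
  obtain ⟨k, hk, hK⟩ := D.semi.2 ⟨r, hr, hD⟩
  refine ⟨?_, ?_⟩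
  · rintro ⟨M, Δ⟩ Γ hΓ hQe
    simp only [Sequent.mk.injEq] at hQe
    obtain ⟨hAe, rfl⟩ := hQe
    obtain ⟨A, B, rfl, rfl, rfl⟩ := exists_map_split hAe
    -- With no boxed formula outside the `p`-free part, the derivable conclusion lies entirely in
    -- that part, and right weakening supplies the succedent.
    by_cases hA0 : A = 0
    · subst hA0
      simpa using D.int.weakR_one hQ
    have hB : ∀ χ ∈ B, χ.Free p := fun χ hχ =>
      Form.free_app1.1 (hΓ _ (Multiset.mem_map_of_mem _ hχ))
    have h₁ := D.boxK_derivable hk hK hb (D.fst_of_interpolates (S := ⟨A, 0⟩)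
      (single_of_suc rfl) hB h)
    rw [← below_eq (F := F) (D.lt_box_ant hb hA0) (single_of_suc rfl)] at h₁
    refine D.disjunct_right (single_of_suc rfl) (.boxD r hr hD b hb A hA0 rfl) ?_
    rw [add_comm]
    exact D.int.weakL _ h₁
  · rintro M Γ Δ hΓ hΔ hQe
    simp only [Sequent.mk.injEq] at hQe
    obtain ⟨hAe, rfl⟩ := hQe
    obtain ⟨A, B, rfl, rfl, rfl⟩ := exists_map_split hAe
    by_cases hA0 : A = 0
    · subst hA0
      simpa using hQ
    have hB : ∀ χ ∈ B, χ.Free p := fun χ hχ =>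
      Form.free_app1.1 (hΓ _ (Multiset.mem_map_of_mem _ hχ))
    have h₁ := h.2 A B 0 hB (by simp) rfl
    rw [leftCtx_of_ne hA0, add_comm] at h₁
    have h₂ := D.boxD_derivable hr hD hb (by simp) h₁
    refine D.conjunct_left (by simpa using hA0) (.box k hk hK b hb A hA0 rfl) ?_
    rw [below_eq (D.lt_box_ant hb hA0) (single_of_suc rfl)]
    simpa using h₂

theorem block_right {f : Sequent L α → Form L α × Form L α} {l : List (Sequent L α)}
    (h : ∀ t ∈ l, H.Derivable ⟨Γ, {(f ⟨X + t.ant, t.suc⟩).1}⟩) :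
    H.Derivable ⟨Γ, {blockForm f X l}⟩ :=
  D.int.bigAndR fun φ hφ => by
    obtain ⟨t, ht, rfl⟩ := List.mem_map.1 hφ
    exact h t ht

/-- If the principal formula belongs to `S`, the contexts are divided and the fusion of the block
interpolants is proved blockwise. If it is `p`-free, so are the formulas added in the premises, and
the rule is applied again with the left interpolants in its contexts. -/
theorem interpolates_right {r : Rule L α} (hr : r ∈ R) {ℓ : RightInst L α}
    (hℓ : ℓ ∈ r.rightFam) (hok : ℓ.Ok) (X : ℓ.ι → Multiset (Form L α))
    (h : ∀ Q ∈ ℓ.prems X, Interpolates H R p lt I J F Q) :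
    Interpolates H R p lt I J F (ℓ.concl X) := by
  refine ⟨?_, ?_⟩
  · rintro ⟨M, Δ⟩ Γ hΓ hQ
    simp only [RightInst.concl, Sequent.mk.injEq] at hQ
    obtain ⟨hA, rfl⟩ := hQ
    obtain ⟨Y, Z, hYZ, rfl, rfl⟩ := exists_split_sum _ _ hA
    have hS : Sequent.Single (⟨∑ i, Y i, {ℓ.φ}⟩ : Sequent L α) := by simp [Sequent.Single]
    refine D.disjunct_right hS (.right r hr ℓ hℓ hok Y rfl) ?_
    rw [add_comm]
    refine D.int.weakL _ (D.int.famFusR fun i => D.block_right fun t ht => ?_)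
    have hmem : (⟨Y i + t.ant, t.suc⟩ : Sequent L α) ∈ ℓ.prems Y := ⟨i, t, ht, rfl⟩
    have hl := D.lt_of_hasInst hr ((r.rightFamily_of_mem hℓ).hasInst ℓ hℓ Y) hS hok.single _ hmem
    have hs : Sequent.Single (⟨Y i + t.ant, t.suc⟩ : Sequent L α) := hok i t ht
    change lt _ ⟨∑ i, Y i, {ℓ.φ}⟩ at hl
    rw [below_eq hl hs]
    refine D.fst_of_interpolates hs (fun χ hχ => hΓ χ ?_) ?_
    · exact Multiset.mem_sum.2 ⟨i, Finset.mem_univ i, hχ⟩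
    · refine h _ ⟨i, t, ht, ?_⟩
      rw [hYZ i (Finset.mem_univ i), add_right_comm]
  · rintro M Γ Δ hΓ hΔ hQ
    simp only [RightInst.concl, Sequent.mk.injEq] at hQ
    obtain ⟨hA, rfl⟩ := hQ
    obtain ⟨Y, Z, hYZ, rfl, rfl⟩ := exists_split_sum _ _ hA
    have hfree : ℓ.Free p := (r.rightFamily_of_mem hℓ).free p ℓ hℓ
      (hΔ _ (Multiset.mem_singleton_self _))
    apply D.leftCtx_sum
    rw [← Finset.sum_add_distrib]
    refine D.right_derivable hr hℓ _ fun i t ht => ?_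
    rw [add_assoc]
    refine (h ⟨Y i + (Z i + t.ant), t.suc⟩ ⟨i, t, ht, ?_⟩).2 (Y i) (Z i + t.ant) t.suc ?_ ?_ rfl
    · rw [hYZ i (Finset.mem_univ i), add_assoc]
    · intro χ hχ
      rcases Multiset.mem_add.1 hχ with hχ | hχ
      · exact hΓ χ (Multiset.mem_sum.2 ⟨i, Finset.mem_univ i, hχ⟩)
      · exact hfree i t ht χ (Multiset.mem_add.2 (.inl hχ))
    · exact fun χ hχ => hfree i t ht χ (Multiset.mem_add.2 (.inr hχ))

section Left

variable {r : Rule L α} (hr : r ∈ R) {ℓ : LeftInst L α} (hℓ : ℓ ∈ r.leftFam) (hok : ℓ.Ok)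
  {Y Z : ℓ.ι → Multiset (Form L α)} {Y₀ Z₀ : Multiset (Form L α)}

include hr hℓ

/-- A left rule with `p`-free principal formula, applied to premises which the left interpolants
of parts of the context have entered. -/
theorem left_of_free (hφ : ℓ.φ.Free p)
    (hZ : ∀ i, ∀ χ ∈ Z i, χ.Free p) (hZ₀ : ∀ χ ∈ Z₀, χ.Free p) (hΔ : Multiset.card Δ ≤ 1)
    (hT : ∀ i, ∀ t ∈ ℓ.T i, Interpolates H R p lt I J F ⟨Y i + Z i + t.ant, t.suc⟩)
    (hT₀ : ∀ t ∈ ℓ.T₀, Interpolates H R p lt I J F ⟨Y₀ + Z₀ + t.ant, t.suc⟩)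
    (hS : ∀ Φ ∈ ℓ.S, H.Derivable ⟨leftCtx F Y₀ + (Z₀ + Φ), Δ⟩) :
    H.Derivable ⟨leftCtx F (∑ i, Y i + Y₀) + (∑ i, Z i + Z₀ + {ℓ.φ}), Δ⟩ := by
  obtain ⟨hf, hf₀, -⟩ := (r.leftFamily_of_mem hℓ).free p ℓ hℓ hφ
  have hprem : ∀ (A B : Multiset (Form L α)) (t : Sequent L α), (∀ χ ∈ B, χ.Free p) → t.Free p →
      Interpolates H R p lt I J F ⟨A + B + t.ant, t.suc⟩ →
      H.Derivable ⟨leftCtx F A + B + t.ant, t.suc⟩ := by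
    intro A B t hB ht h
    rw [add_assoc]
    refine h.2 A (B + t.ant) t.suc (fun χ hχ => ?_)
      (fun χ hχ => ht χ (Multiset.mem_add.2 (.inr hχ))) (by rw [add_assoc])
    rcases Multiset.mem_add.1 hχ with hχ | hχ
    exacts [hB χ hχ, ht χ (Multiset.mem_add.2 (.inl hχ))]
  have := D.left_derivable hr hℓ (fun i => leftCtx F (Y i) + Z i) (leftCtx F Y₀ + Z₀) hΔ
    (fun i t ht => hprem _ _ t (hZ i) (hf i t ht) (hT i t ht))
    (fun t ht => hprem _ _ t hZ₀ (hf₀ t ht) (hT₀ t ht))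
    (fun Φ hΦ => by rw [add_assoc]; exact hS Φ hΦ)
  rw [Finset.sum_add_distrib] at this
  apply D.leftCtx_add
  rw [add_assoc]
  apply D.leftCtx_sum
  convert this using 2
  abel

include hok

theorem left_of_principal (hΓ : ∀ i, ∀ χ ∈ Z i, χ.Free p) (hΓ₀ : ∀ χ ∈ Z₀, χ.Free p)
    (hΔ : Multiset.card Δ ≤ 1)
    (h : ∀ Q ∈ ℓ.prems (fun i => Y i + Z i) (Y₀ + Z₀) Δ, Interpolates H R p lt I J F Q) :
    H.Derivable ⟨leftCtx F (∑ i, Y i + Y₀ + {ℓ.φ}) + (∑ i, Z i + Z₀),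
      {rightStep R I J (below lt F ⟨∑ i, Y i + Y₀ + {ℓ.φ}, Δ⟩) ⟨∑ i, Y i + Y₀ + {ℓ.φ}, Δ⟩}⟩ := by
  refine D.disjunct_right (S := ⟨∑ i, Y i + Y₀ + {ℓ.φ}, Δ⟩) hΔ
    (.left r hr ℓ hℓ hok Y Y₀ rfl) ?_
  have hlt := D.lt_of_hasInst hr (left_hasInst hℓ Y Y₀ Δ) hΔ (hok.single hΔ)
  change ∀ Q ∈ _, lt Q ⟨∑ i, Y i + Y₀ + {ℓ.φ}, Δ⟩ at hlt
  have hprem : ∀ (A B Φ Θ : Multiset (Form L α)), (∀ χ ∈ B, χ.Free p) →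
      ⟨A + Φ, Θ⟩ ∈ ℓ.prems Y Y₀ Δ → Interpolates H R p lt I J F ⟨A + B + Φ, Θ⟩ →
      H.Derivable ⟨B, {(below lt F ⟨∑ i, Y i + Y₀ + {ℓ.φ}, Δ⟩ ⟨A + Φ, Θ⟩).1}⟩ := by
    intro A B Φ Θ hB hmem h
    have hs := hok.single hΔ _ hmem
    rw [below_eq (hlt _ hmem) hs]
    refine D.fst_of_interpolates hs hB ?_
    rwa [add_right_comm]
  rw [add_comm]
  refine D.int.weakL _ (D.int.fusR (D.int.famFusR fun i => D.block_right fun t ht => ?_)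
    (D.block_right fun t ht => ?_))
  · exact hprem _ _ _ _ (hΓ i) (.inl ⟨i, t, ht, rfl⟩) (h _ (.inl ⟨i, t, ht, rfl⟩))
  · rcases List.mem_append.1 ht with ht | ht
    · exact hprem _ _ _ _ hΓ₀ (.inr (.inl ⟨t, ht, rfl⟩)) (h _ (.inr (.inl ⟨t, ht, rfl⟩)))
    · obtain ⟨Φ, hΦ, rfl⟩ := List.mem_map.1 ht
      exact hprem _ _ _ _ hΓ₀ (.inr (.inr ⟨Φ, hΦ, rfl⟩)) (h _ (.inr (.inr ⟨Φ, hΦ, rfl⟩)))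

theorem conjunct_of_principal (hΓ : ∀ i, ∀ χ ∈ Z i, χ.Free p) (hΓ₀ : ∀ χ ∈ Z₀, χ.Free p)
    (hΔf : ∀ χ ∈ Δ, χ.Free p) (hΔ : Multiset.card Δ ≤ 1)
    (h : ∀ Q ∈ ℓ.prems (fun i => Y i + Z i) (Y₀ + Z₀) Δ, Interpolates H R p lt I J F Q) :
    H.Derivable ⟨leftCtx F (∑ i, Y i + Y₀ + {ℓ.φ}) + (∑ i, Z i + Z₀), Δ⟩ := by
  refine D.conjunct_left (by simp) (.left r hr ℓ hℓ hok Y Y₀ rfl) ?_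
  have h0 : Multiset.card (0 : Multiset (Form L α)) ≤ 1 := by simp
  have hlt := D.lt_of_hasInst hr (left_hasInst hℓ Y Y₀ 0) h0 (hok.single h0)
  change ∀ Q ∈ _, lt Q ⟨∑ i, Y i + Y₀ + {ℓ.φ}, 0⟩ at hlt
  have hprem : ∀ (A B Φ Θ : Multiset (Form L α)), (∀ χ ∈ B, χ.Free p) →
      ⟨A + Φ, Θ⟩ ∈ ℓ.prems Y Y₀ 0 → Interpolates H R p lt I J F ⟨A + B + Φ, Θ⟩ →
      H.Derivable ⟨B, {(below lt F ⟨∑ i, Y i + Y₀ + {ℓ.φ}, 0⟩ ⟨A + Φ, Θ⟩).1}⟩ := by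
    intro A B Φ Θ hB hmem h
    have hs := hok.single h0 _ hmem
    rw [below_eq (hlt _ hmem) hs]
    refine D.fst_of_interpolates hs hB ?_
    rwa [add_right_comm]
  -- `impL` divides the side formulas between the `Z i` and `Z₀`, whereas `impCS` uses `Z₀` for both
  -- `ℓ.T₀` and `ℓ.S`.
  refine D.int.impL (D.int.famFusR fun i => D.block_right fun t ht => ?_)
    (D.int.impCS (D.block_right fun t ht => ?_) (D.int.bigOrL hΔ fun ψ hψ => ?_))
  · exact hprem _ _ _ _ (hΓ i) (.inl ⟨i, t, ht, rfl⟩) (h _ (.inl ⟨i, t, ht, rfl⟩))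
  · exact hprem _ _ _ _ hΓ₀ (.inr (.inl ⟨t, ht, rfl⟩)) (h _ (.inr (.inl ⟨t, ht, rfl⟩)))
  · obtain ⟨Φ, hΦ, rfl⟩ := List.mem_map.1 hψ
    rw [below_eq (hlt _ (.inr (.inr ⟨Φ, hΦ, rfl⟩))) (single_of_suc rfl)]
    -- The principal formula may contain `p`, and so may `Φ`, which is therefore counted with `Y₀`.
    refine D.int.weakL_of_le ?_ ((h _ (.inr (.inr ⟨Φ, hΦ, rfl⟩))).2 (Y₀ + Φ) Z₀ Δ hΓ₀ hΔf (by
      rw [add_right_comm]))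
    rw [add_comm]
    exact add_le_add_right (leftCtx_le F _) _

/-- Any partition of the conclusion divides each context and puts the principal formula on one side.
The delicate case is the right interpolant with a `p`-free principal formula, where the premises
from `ℓ.S` concern `Y₀ ⇒ Δ` and not the whole of `S`. -/
theorem interpolates_left (X : ℓ.ι → Multiset (Form L α)) (X₀ : Multiset (Form L α))
    (hΔ : Multiset.card Δ ≤ 1)
    (h : ∀ Q ∈ ℓ.prems X X₀ Δ, Interpolates H R p lt I J F Q) :
    Interpolates H R p lt I J F (ℓ.concl X X₀ Δ) := by
  have split : ∀ {A B : Multiset (Form L α)}, ∑ i, X i + X₀ + {ℓ.φ} = A + B →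
      ∃ (Y Z : ℓ.ι → Multiset (Form L α)) (Y₀ Z₀ P P' : Multiset (Form L α)),
        X = (fun i => Y i + Z i) ∧ X₀ = Y₀ + Z₀ ∧ {ℓ.φ} = P + P' ∧
        A = ∑ i, Y i + Y₀ + P ∧ B = ∑ i, Z i + Z₀ + P' := by
    intro A B hAB
    obtain ⟨C₁, C₂, P, P', hC, hP, rfl, rfl⟩ := exists_split_add hAB
    obtain ⟨E₁, E₂, Y₀, Z₀, hE, hX₀, rfl, rfl⟩ := exists_split_add hC
    obtain ⟨Y, Z, hYZ, rfl, rfl⟩ := exists_split_sum _ _ hE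
    exact ⟨Y, Z, Y₀, Z₀, P, P', funext fun i => hYZ i (Finset.mem_univ i), hX₀, hP, rfl, rfl⟩
  refine ⟨?_, ?_⟩
  · rintro ⟨M, Δ'⟩ Γ hΓ hQ
    simp only [LeftInst.concl, Sequent.mk.injEq] at hQ
    obtain ⟨hA, rfl⟩ := hQ
    obtain ⟨Y, Z, Y₀, Z₀, P, P', rfl, rfl, hP, rfl, rfl⟩ := split hA
    have hZ : ∀ i, ∀ χ ∈ Z i, χ.Free p := fun i χ hχ => hΓ χ (Multiset.mem_add.2 (.inl
      (Multiset.mem_add.2 (.inl (Multiset.mem_sum.2 ⟨i, Finset.mem_univ i, hχ⟩)))))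
    have hZ₀ : ∀ χ ∈ Z₀, χ.Free p := fun χ hχ => hΓ χ (Multiset.mem_add.2 (.inl
      (Multiset.mem_add.2 (.inr hχ))))
    rcases singleton_eq_add hP with ⟨rfl, rfl⟩ | ⟨rfl, rfl⟩
    · simpa only [add_zero] using D.left_of_principal hr hℓ hok hZ hZ₀ hΔ h
    · simp only [add_zero]
      have hφ : ℓ.φ.Free p := hΓ _ (by simp)
      have hS : Sequent.Single (⟨∑ i, Y i + Y₀, Δ⟩ : Sequent L α) := hΔ
      -- The succedent of the conclusion is a context of the rule, so any formula proved by all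
      -- premises from `ℓ.S` may take its place.
      have key (χ : Form L α) := D.left_of_free hr hℓ hφ hZ hZ₀ (Δ := {χ}) (by simp)
        (fun i t ht => h _ (.inl ⟨i, t, ht, rfl⟩))
        (fun t ht => h _ (.inr (.inl ⟨t, ht, rfl⟩)))
      obtain ⟨-, -, hfS⟩ := (r.leftFamily_of_mem hℓ).free p ℓ hℓ hφ
      have hpart : ∀ Φ ∈ ℓ.S, H.Derivable ⟨leftCtx F Y₀ + (Z₀ + Φ),
          {rightStep R I J (below lt F ⟨Y₀, Δ⟩) ⟨Y₀, Δ⟩}⟩ := by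
        intro Φ hΦ
        refine (h _ (.inr (.inr ⟨Φ, hΦ, rfl⟩))).1 ⟨Y₀, Δ⟩ (Z₀ + Φ) (fun χ hχ => ?_)
          (by rw [add_assoc])
        rcases Multiset.mem_add.1 hχ with hχ | hχ
        exacts [hZ₀ χ hχ, hfS Φ hΦ χ hχ]
      -- Either `Y₀ ⇒ Δ` is already the sequent to be interpolated, or it is a proper subsequent and
      -- the disjunct `sub` applies.
      by_cases hY : ∑ i, Y i = 0
      · apply key
        intro Φ hΦ
        rw [hY, zero_add]
        exact hpart Φ hΦ
      · have hlt : Y₀ < ∑ i, Y i + Y₀ :=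
          lt_of_le_of_ne (Multiset.le_add_left _ _) fun e => hY (by simpa using e)
        refine D.disjunct_right hS (.sub Y₀ hlt) (key _ fun Φ hΦ => ?_)
        have hl : lt ⟨Y₀, Δ⟩ ⟨∑ i, Y i + Y₀, Δ⟩ := D.lt_sub _ _ hS ⟨hlt.le, le_rfl⟩ fun e =>
          hlt.ne (congrArg Sequent.ant e)
        rw [below_eq hl hΔ, add_comm]
        exact D.int.weakL _ (D.fst_right (S := ⟨Y₀, Δ⟩) hΔ (hpart Φ hΦ))
  · rintro M Γ Δ' hΓ hΔf hQ
    simp only [LeftInst.concl, Sequent.mk.injEq] at hQ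
    obtain ⟨hA, rfl⟩ := hQ
    obtain ⟨Y, Z, Y₀, Z₀, P, P', rfl, rfl, hP, rfl, rfl⟩ := split hA
    have hZ : ∀ i, ∀ χ ∈ Z i, χ.Free p := fun i χ hχ => hΓ χ (Multiset.mem_add.2 (.inl
      (Multiset.mem_add.2 (.inl (Multiset.mem_sum.2 ⟨i, Finset.mem_univ i, hχ⟩)))))
    have hZ₀ : ∀ χ ∈ Z₀, χ.Free p := fun χ hχ => hΓ χ (Multiset.mem_add.2 (.inl
      (Multiset.mem_add.2 (.inr hχ))))
    rcases singleton_eq_add hP with ⟨rfl, rfl⟩ | ⟨rfl, rfl⟩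
    · simpa only [add_zero] using D.conjunct_of_principal hr hℓ hok hZ hZ₀ hΔf hΔ h
    · simp only [add_zero]
      have hφ : ℓ.φ.Free p := hΓ _ (by simp)
      obtain ⟨-, -, hfS⟩ := (r.leftFamily_of_mem hℓ).free p ℓ hℓ hφ
      refine D.left_of_free hr hℓ hφ hZ hZ₀ hΔ
        (fun i t ht => h _ (.inl ⟨i, t, ht, rfl⟩))
        (fun t ht => h _ (.inr (.inl ⟨t, ht, rfl⟩))) fun Φ hΦ => ?_
      refine (h _ (.inr (.inr ⟨Φ, hΦ, rfl⟩))).2 Y₀ (Z₀ + Φ) Δ (fun χ hχ => ?_) hΔf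
        (by rw [add_assoc])
      rcases Multiset.mem_add.1 hχ with hχ | hχ
      exacts [hZ₀ χ hχ, hfS Φ hΦ χ hχ]

end Left

/-- The induction follows the derivation and not the order: when the principal formula is `p`-free,
the step down to the premises need not make the sequent being interpolated any smaller. -/
theorem interpolates_of_derivable (h : H.Derivable Q) : Interpolates H R p lt I J F Q := by
  induction h with
  | step r hr σ hσ h ih =>
    have hder : H.Derivable (r.concl.inst σ) := .step r hr σ hσ h
    have hr' := hr
    rw [D.ext] at hr'
    have leftCase : (∃ 𝓛, r.LeftFamily 𝓛) → r ∈ R →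
        Interpolates H R p lt I J F (r.concl.inst σ) := by
      intro hfam hrR
      obtain ⟨ℓ, hℓ, X, X₀, Δ, hc, hP⟩ := (r.leftFamily_leftFam hfam).exists_inst σ hσ.1
      have hi : ∀ Q ∈ ℓ.prems X X₀ Δ, Interpolates H R p lt I J F Q := by
        intro Q hQ
        obtain ⟨M, hM, rfl⟩ := hP Q hQ
        exact ih M hM
      have hs : ∀ Q ∈ ℓ.prems X X₀ Δ, Q.Single := by
        intro Q hQ
        obtain ⟨M, hM, rfl⟩ := hP Q hQ
        exact hσ.2 M hM
      have hok : ℓ.Ok := ⟨fun i t ht => hs ⟨X i + t.ant, t.suc⟩ (.inl ⟨i, t, ht, rfl⟩),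
        fun t ht => hs ⟨X₀ + t.ant, t.suc⟩ (.inr (.inl ⟨t, ht, rfl⟩))⟩
      have hΔ := hσ.1
      rw [hc] at hΔ ⊢
      exact D.interpolates_left hrR hℓ hok X X₀ hΔ hi
    rcases hr' with ⟨S, hS, rfl⟩ | hrR
    · rw [Rule.inst_ofSequent] at hder ⊢
      exact D.interpolates_ax hS hder
    · rcases D.semi.1 r hrR with (hl | hri | hK | hD) | hcs
      · exact leftCase hl.exists_family hrR
      · obtain ⟨ℓ, hℓ, X, hc, hP⟩ := (r.rightFamily_rightFam hri.exists_family).exists_inst σ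
        rw [hc]
        refine D.interpolates_right hrR hℓ (fun i t ht => ?_) X fun Q hQ => ?_
        · obtain ⟨M, hM, he⟩ := hP _ ⟨i, t, ht, rfl⟩
          have := hσ.2 M hM
          rw [he] at this
          exact this
        · obtain ⟨M, hM, rfl⟩ := hP Q hQ
          exact ih M hM
      · obtain ⟨b, hb, A, φ, hc, M, hM, he⟩ := hK.exists_inst σ
        rw [hc]
        exact D.interpolates_boxK hrR hK hb (he ▸ ih M hM)
      · obtain ⟨b, hb, A, hA, hc, M, hM, he⟩ := hD.exists_inst σ
        rw [hc] at hder ⊢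
        exact D.interpolates_boxD hrR hD hb hA hder (he ▸ ih M hM)
      · exact leftCase hcs.exists_family hrR

end InterpolationData

end UniversalProofTheory

/-! ### The theorem -/

theorem mainTheorem4 {L : UniversalProofTheory.PropLang.{u}} {α : Type v}
    (G H R : UniversalProofTheory.Calculus L α)
    (hFLe : H.Extends (UniversalProofTheory.calculusFLe L α))
    (hLw : H.Admits (UniversalProofTheory.leftWeakening L α))
    (hRw : H.Admits (UniversalProofTheory.rightWeakening L α))
    (hImp : H.Admits (UniversalProofTheory.contextSharingImpL L α))
    (hTerm : H.Terminating)
    (hExt : H.IsAxiomaticExtension G R)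
    (hR : R.ConsistsOfSemiAnalyticRules)
    (hG : G.HasWeakUniformInterpolation H) :
    H.HasWeakUniformInterpolation H := by
  intro p
  obtain ⟨hfin, lt, hwf, hprem, hsub, hbox⟩ := hTerm
  obtain ⟨I, J, hI, hJ⟩ := hG p
  obtain ⟨F, hF⟩ := UniversalProofTheory.exists_isInterpolant R hwf I J
  have D : UniversalProofTheory.InterpolationData G H R p lt I J F :=
    ⟨⟨hFLe, hLw, hRw, hImp⟩, hExt, hR, hfin, hwf, hprem, hsub, hbox, hI, hJ, hF⟩
  refine ⟨fun S => (F S).1, fun T => (F T).2, fun S hS => ⟨(D.free S hS).1, ?_, ?_⟩,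
    fun T hT => ?_⟩
  · simpa [HMul.hMul, Mul.mul] using (D.sound S hS).1
  · intro Γ hΓ h
    have h' : H.Derivable ⟨S.ant + Γ, S.suc⟩ := by simpa [HMul.hMul, Mul.mul] using h
    -- The right interpolant is obtained without the left one in the antecedent; weakening adds it.
    have := D.int.weakL_one (φ := (F S.tilde).2)
      (D.fst_of_interpolates hS hΓ (D.interpolates_of_derivable h'))
    rwa [add_comm, Multiset.singleton_add] at this
  · have hTs : T.Single := UniversalProofTheory.InterpolationData.single_of_suc hT
    have hTe : (⟨T.ant, 0⟩ : UniversalProofTheory.Sequent L α) = T := by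
      ext1
      exacts [rfl, hT.symm]
    refine ⟨(D.free T hTs).2, ?_, ?_⟩
    · simpa [HMul.hMul, Mul.mul, hT] using (D.sound T hTs).2
    · intro Γ Δ hΓ hΔ h
      have h' : H.Derivable ⟨T.ant + Γ, Δ⟩ := by simpa [HMul.hMul, Mul.mul, hT] using h
      refine D.int.weakL_of_le ?_ ((D.interpolates_of_derivable h').2 T.ant Γ Δ hΓ hΔ rfl)
      rw [← Multiset.singleton_add]
      refine add_le_add_left ?_ _
      have := UniversalProofTheory.leftCtx_le F T.ant
      rwa [hTe] at this
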